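/- Let $J_1,J_2,J_3$ be ferromagnetic couplings on the triangular lattice ($J_1,J_2,J_3>0$, $s=1$, reference coupling $J_{\rm ref}=J_1$), the square lattice ($J_1,J_2>0$, $J_3=0$, $s=1$, $J_{\rm ref}=J_1$; formulas of the triangular lattice) or the hexagonal lattice ($J_1,J_2,J_3>0$, $s=2$, $J_{\rm ref}=J_2$). For $\eta=J_{\rm ref}/k_BT>0$ put $\eta_i=(J_i/J_{\rm ref})\eta$, $t_i=\tanh\eta_i$, $r_{ij}=J_i/J_j$, and $$\alpha_0=1+t_1t_2t_3,\quad \alpha_1=t_1+t_2t_3,\quad \alpha_2=t_2+t_3t_1,\quad \alpha_3=t_3+t_1t_2,\quad R=2\cosh\eta_1\cosh\eta_2\cosh\eta_3$$ for the triangular and square lattices, $$\alpha_0=1,\quad \alpha_1=t_3t_1,\quad \alpha_2=t_2t_3,\quad \alpha_3=t_1t_2,\quad R=2(\cosh\eta_1\cosh\eta_2\cosh\eta_3)^{1/2}$$ for the hexagonal lattice. Let $A_0=\sum_{\mu=0}^{3}\alpha_\mu^2$, $A_1=2(\alpha_0\alpha_1-\alpha_2\alpha_3)$, $A_2=2(\alpha_0\alpha_2-\alpha_3\alpha_1)$,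 $A_3=2(\alpha_0\alpha_3-\alpha_1\alpha_2)$. For an integer $L\ge 1$ the free energy per site and per $k_BT$ of the infinitely long Ising cylinder of circumference $L$ is taken to be given by the closed expression $$f=-\ln R+\sum_{p} f_p,\qquad f_p=-\frac1{2sL}\int_0^{2\pi}\frac{d\phi}{2\pi}\ln\Bigl[A_0-A_1\cos\tfrac{2\pi p}{L}-A_2\cos\phi-A_3\cos\bigl(\tfrac{2\pi p}{L}-\phi\bigr)\Bigr],$$ where $p$ runs over $0,1,\dots,L-1$ for antiperiodically joined circumference (AJC) and over $\tfrac12,\tfrac32,\dots,L-\tfrac12$ for periodically joined circumference (PJC); $f$ below means the function so defined. Put $\epsilon=\partial f/\partial\eta$ and $c=-\eta^2\,\partial^2f/\partial\eta^2$, with the ratios $r_{ij}$ fixed. Then the equation $A_0-A_1-A_2-A_3=0$ has exactly one solution $\eta_c>0$ (the bulk critical point), with $T_c=J_{\rm ref}/(k_B\eta_c)$, and: 1. For AJC, $f$ is continuous on $(0,\infty)$, twice continuously differentiable on $(0,\infty)\setminus\{\eta_c\}$, and has unequal left and right derivatives at $\eta_c$ (a first-order transition). 2. For AJC, the one-sided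 limits of $\epsilon$ and $c$ at $T_c$ exist and are finite, and $$\lim_{T\to T_c^+}\epsilon-\lim_{T\to T_c^-}\epsilon=\Delta_\epsilon=\frac{a_\epsilon}{sL},\qquad \lim_{T\to T_c^+}c-\lim_{T\to T_c^-}c=\Delta_c=\frac{a_c}{sL},$$ where $a_\epsilon,a_c>0$ are, with all $t_i$ evaluated at $\eta_c$, $$a_\epsilon=2+r_{31}\frac{(1-t_3^2)(1+t_2^2)}{(t_3+t_2)(1-t_2t_3)}+r_{21}\frac{(1+t_3^2)(1-t_2^2)}{(t_3+t_2)(1-t_2t_3)},$$ $$\frac{a_c}{\eta_c^2}=(r_{31}-r_{21})^2\frac{(1-t_3^4)(1-t_2^4)}{(t_3+t_2)^2(1-t_2t_3)^2}+4r_{31}r_{21}\frac{(1-t_3^2)(1-t_2^2)}{(t_3+t_2)^2}$$ for the triangular and square lattices, and $$a_\epsilon=r_{12}\frac{(1+t_3^2)(1-t_1^2)}{(t_3+t_1)(1-t_1t_3)}+r_{32}\frac{(1-t_3^2)(1+t_1^2)}{(t_3+t_1)(1-t_1t_3)}+\frac{1-t_2^2}{t_2},$$ $$\frac{a_c}{\eta_c^2}=(r_{32}-r_{12})^2\frac{(1-t_3^4)(1-t_1^4)}{(t_3+t_1)^2(1-t_1t_3)^2}+4r_{32}r_{12}\frac{(1-t_3^2)(1-t_1^2)}{(t_3+t_1)^2}+\frac{1-t_2^4}{t_2^2}$$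 for the hexagonal lattice. 3. The jumps come only from the zero mode: $\ln R$ and all $f_p$ with $p=1,\dots,L-1$ are twice continuously differentiable on $(0,\infty)$, and with $$G(0,\eta)=\frac{[A_2^2+A_3^2+2A_2A_3]^{1/2}}{A_0-A_1},\quad D_\epsilon=\frac{1}{\sqrt{1-G(0,\eta)^2}}\frac{\partial}{\partial\eta}\ln G(0,\eta),\quad D_c=-\frac{\partial D_\epsilon}{\partial\eta},$$ one has $$\Delta_\epsilon=\frac1{2sL}\lim_{x\to0^+}\bigl[D_\epsilon(\eta_c-x)-D_\epsilon(\eta_c+x)\bigr],\qquad \Delta_c=\frac{\eta_c^2}{2sL}\lim_{x\to0^+}\bigl[D_c(\eta_c-x)-D_c(\eta_c+x)\bigr].$$ 4. For PJC, $f$ is twice continuously differentiable on $(0,\infty)$; neither $\epsilon$ nor $c$ jumps at $T_c$, and there is no first-order transition there. -/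

import Mathlib

open Filter Topology Set

noncomputable section

namespace IsingCylinder

/-- The planar lattices considered. -/
inductive Lattice where
  | triangular
  | square
  | hexagonal

/-- The two ways of joining the circumference: `σ_{m,L+1} = σ_{m,1}` (periodic) and
`σ_{m,L+1} = -σ_{m,1}` (antiperiodic). -/
inductive Joining where
  | periodic
  | antiperiodic

/-- The coupling constants along the three bond directions. -/
structure Couplings where
  J₁ : ℝ
  J₂ : ℝ
  J₃ : ℝ

/-- Ferromagnetic couplings. The square lattice is the triangular lattice without
the third bond. -/
def Couplings.Ferromagnetic (J : Couplings) : Lattice → Prop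
  | .triangular => 0 < J.J₁ ∧ 0 < J.J₂ ∧ 0 < J.J₃
  | .square => 0 < J.J₁ ∧ 0 < J.J₂ ∧ J.J₃ = 0
  | .hexagonal => 0 < J.J₁ ∧ 0 < J.J₂ ∧ 0 < J.J₃

/-- The coupling used as reference scale: `η = Jref / (k_B T)`. -/
def Jref : Lattice → Couplings → ℝ
  | .triangular, J => J.J₁
  | .square, J => J.J₁
  | .hexagonal, J => J.J₂

/-- Number of sites per unit cell. -/
def cellSites : Lattice → ℝ
  | .triangular => 1
  | .square => 1
  | .hexagonal => 2

section Weights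

variable (Λ : Lattice) (J : Couplings)

/-- `η_i = J_i / (k_B T) = (J_i / Jref) η`. -/
def η₁ (η : ℝ) : ℝ := J.J₁ / Jref Λ J * η
def η₂ (η : ℝ) : ℝ := J.J₂ / Jref Λ J * η
def η₃ (η : ℝ) : ℝ := J.J₃ / Jref Λ J * η

def t₁ (η : ℝ) : ℝ := Real.tanh (η₁ Λ J η)
def t₂ (η : ℝ) : ℝ := Real.tanh (η₂ Λ J η)
def t₃ (η : ℝ) : ℝ := Real.tanh (η₃ Λ J η)

def α₀ (η : ℝ) : ℝ :=
  match Λ with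
  | .hexagonal => 1
  | _ => 1 + t₁ Λ J η * t₂ Λ J η * t₃ Λ J η

def α₁ (η : ℝ) : ℝ :=
  match Λ with
  | .hexagonal => t₃ Λ J η * t₁ Λ J η
  | _ => t₁ Λ J η + t₂ Λ J η * t₃ Λ J η

def α₂ (η : ℝ) : ℝ :=
  match Λ with
  | .hexagonal => t₂ Λ J η * t₃ Λ J η
  | _ => t₂ Λ J η + t₃ Λ J η * t₁ Λ J η

def α₃ (η : ℝ) : ℝ :=
  match Λ with
  | .hexagonal => t₁ Λ J η * t₂ Λ J η
  | _ => t₃ Λ J η + t₁ Λ J η * t₂ Λ J η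

def A₀ (η : ℝ) : ℝ := α₀ Λ J η ^ 2 + α₁ Λ J η ^ 2 + α₂ Λ J η ^ 2 + α₃ Λ J η ^ 2
def A₁ (η : ℝ) : ℝ := 2 * (α₀ Λ J η * α₁ Λ J η - α₂ Λ J η * α₃ Λ J η)
def A₂ (η : ℝ) : ℝ := 2 * (α₀ Λ J η * α₂ Λ J η - α₃ Λ J η * α₁ Λ J η)
def A₃ (η : ℝ) : ℝ := 2 * (α₀ Λ J η * α₃ Λ J η - α₁ Λ J η * α₂ Λ J η)

/-- The regular prefactor of the partition function per site in the high-temperature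
normalisation: `2` for the spin and one factor `cosh η_i` for each bond, a site of the hexagonal
lattice owning half a bond of each kind. -/
def R (η : ℝ) : ℝ :=
  match Λ with
  | .hexagonal =>
      2 * √(Real.cosh (η₁ Λ J η) * Real.cosh (η₂ Λ J η) * Real.cosh (η₃ Λ J η))
  | _ => 2 * (Real.cosh (η₁ Λ J η) * Real.cosh (η₂ Λ J η) * Real.cosh (η₃ Λ J η))

/-- `η` is the bulk critical point of the Ising transition. -/
def IsCritical (η : ℝ) : Prop :=
  0 < η ∧ A₀ Λ J η - A₁ Λ J η - A₂ Λ J η - A₃ Λ J η = 0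

end Weights

/-- The offset of the momenta `p = pbar + Δ`. -/
def Joining.shift : Joining → ℝ
  | .periodic => 1 / 2
  | .antiperiodic => 0

section FreeEnergy

variable (Λ : Lattice) (J : Couplings) (L : ℕ)

/-- Contribution of the mode `p` to the free energy per site. -/
def modeFreeEnergy (p η : ℝ) : ℝ :=
  -(1 / (2 * cellSites Λ * L)) *
    ((∫ φ in (0 : ℝ)..(2 * Real.pi),
      Real.log (A₀ Λ J η - A₁ Λ J η * Real.cos (2 * Real.pi * p / L)
        - A₂ Λ J η * Real.cos φ - A₃ Λ J η * Real.cos (2 * Real.pi * p / L - φ)))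
      / (2 * Real.pi))

/-- Free energy per site and per `k_B T` of the infinitely long cylinder of circumference `L`. -/
def freeEnergy (b : Joining) (η : ℝ) : ℝ :=
  -Real.log (R Λ J η) + ∑ pbar ∈ Finset.range L, modeFreeEnergy Λ J L (pbar + b.shift) η

/-- Internal energy density in units of the reference coupling. -/
def internalEnergy (b : Joining) (η : ℝ) : ℝ := deriv (freeEnergy Λ J L b) η

def specificHeat (b : Joining) (η : ℝ) : ℝ := -η ^ 2 * deriv (internalEnergy Λ J L b) η

/-- The reduced inverse temperature `η` at temperature `T`; the same map sends `η_c` to `T_c`. -/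
def reduced (kB T : ℝ) : ℝ := Jref Λ J / (kB * T)

/-- The function `G(p, η)`. -/
def G (p η : ℝ) : ℝ :=
  √(A₂ Λ J η ^ 2 + A₃ Λ J η ^ 2 + 2 * A₂ Λ J η * A₃ Λ J η * Real.cos (2 * Real.pi * p / L)) /
    (A₀ Λ J η - A₁ Λ J η * Real.cos (2 * Real.pi * p / L))

def Dε (p η : ℝ) : ℝ :=
  1 / √(1 - G Λ J L p η ^ 2) * deriv (fun x => Real.log (G Λ J L p x)) η

def Dc (p η : ℝ) : ℝ := -deriv (Dε Λ J L p) η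

end FreeEnergy

section Amplitudes

variable (Λ : Lattice) (J : Couplings)

/-- Gap amplitude of the internal energy, evaluated at the critical point `ηc`. -/
def aε (ηc : ℝ) : ℝ :=
  let t1 := t₁ Λ J ηc
  let t2 := t₂ Λ J ηc
  let t3 := t₃ Λ J ηc
  match Λ with
  | .hexagonal =>
      J.J₁ / J.J₂ * ((1 + t3 ^ 2) * (1 - t1 ^ 2) / ((t3 + t1) * (1 - t1 * t3)))
        + J.J₃ / J.J₂ * ((1 - t3 ^ 2) * (1 + t1 ^ 2) / ((t3 + t1) * (1 - t1 * t3)))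
        + (1 - t2 ^ 2) / t2
  | _ =>
      2 + J.J₃ / J.J₁ * ((1 - t3 ^ 2) * (1 + t2 ^ 2) / ((t3 + t2) * (1 - t2 * t3)))
        + J.J₂ / J.J₁ * ((1 + t3 ^ 2) * (1 - t2 ^ 2) / ((t3 + t2) * (1 - t2 * t3)))

/-- Gap amplitude of the specific heat, evaluated at the critical point `ηc`. -/
def ac (ηc : ℝ) : ℝ :=
  let t1 := t₁ Λ J ηc
  let t2 := t₂ Λ J ηc
  let t3 := t₃ Λ J ηc
  match Λ with
  | .hexagonal =>
      ηc ^ 2 *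
        ((J.J₃ / J.J₂ - J.J₁ / J.J₂) ^ 2 *
            ((1 - t3 ^ 4) * (1 - t1 ^ 4) / ((t3 + t1) ^ 2 * (1 - t1 * t3) ^ 2))
          + 4 * (J.J₃ / J.J₂) * (J.J₁ / J.J₂) *
            ((1 - t3 ^ 2) * (1 - t1 ^ 2) / (t3 + t1) ^ 2)
          + (1 - t2 ^ 4) / t2 ^ 2)
  | _ =>
      ηc ^ 2 *
        ((J.J₃ / J.J₁ - J.J₂ / J.J₁) ^ 2 *
            ((1 - t3 ^ 4) * (1 - t2 ^ 4) / ((t3 + t2) ^ 2 * (1 - t2 * t3) ^ 2))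
          + 4 * (J.J₃ / J.J₁) * (J.J₂ / J.J₁) *
            ((1 - t3 ^ 2) * (1 - t2 ^ 2) / (t3 + t2) ^ 2))

end Amplitudes

/-- `g` has finite one-sided limits at `Tc`, and the limit from above minus the limit from below
is `Δ`. -/
def HasCriticalGap (g : ℝ → ℝ) (Tc Δ : ℝ) : Prop :=
  ∃ above below : ℝ, Tendsto g (𝓝[>] Tc) (𝓝 above) ∧ Tendsto g (𝓝[<] Tc) (𝓝 below) ∧
    above - below = Δ

/-- First-order transition: the free energy is continuous and has unequal left and right
derivatives. -/
def HasFirstOrderTransition (f : ℝ → ℝ) (ηc : ℝ) : Prop :=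
  ContinuousAt f ηc ∧ ∃ l r : ℝ,
    HasDerivWithinAt f l (Iio ηc) ηc ∧ HasDerivWithinAt f r (Ioi ηc) ηc ∧ l ≠ r

end IsingCylinder

end

open IsingCylinder

/-!
For `p = 0` the argument of the logarithm is `H² + C² - 2 H C cos φ`, where `H = α₀ - α₁` and
`C = α₂ + α₃`, so its integral only sees `max H C` and the criticality condition `(H - C)² = 0` says
that the two branches cross. The logarithm `ℓ` of `C / H` satisfies `ℓ' = aε > 0` and
`aε' = -ac / η²`. Hence the crossing is unique, and the antiperiodic free energy is the minimum of
two smooth functions whose difference is `ℓ / (s L)`: the energy jumps by `aε / (s L)` and the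
specific heat by `ac / (s L)`. The gaps of `Dε` and `Dc` are the same ones because
`G(0, η) = 1 / cosh ℓ`, which makes `Dε` equal to `-aε` times the sign of `ℓ`. The discriminant of
every other mode is strictly positive, so that mode, and with it the periodic free energy, is
smooth.
-/

namespace IsingCylinder

open Real

section Analysis

theorem norm_circleMap_zero_sub_sq (ρ φ : ℝ) (v : ℂ) :
    ‖circleMap 0 ρ φ - v‖ ^ 2 = ρ ^ 2 + ‖v‖ ^ 2 - 2 * ρ * (v.re * cos φ + v.im * sin φ) := by
  simp only [← Complex.normSq_eq_norm_sq, Complex.normSq_apply, Complex.sub_re, Complex.sub_im,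
    circleMap_zero, Complex.re_ofReal_mul, Complex.im_ofReal_mul, Complex.exp_ofReal_mul_I_re,
    Complex.exp_ofReal_mul_I_im]
  linear_combination ρ ^ 2 * sin_sq_add_cos_sq φ

theorem integral_log_norm_circleMap_zero_sub_sq {ρ : ℝ} {v : ℂ} (hv : ‖v‖ ≤ |ρ|) :
    ∫ φ in (0 : ℝ)..(2 * π), log (‖circleMap 0 ρ φ - v‖ ^ 2) = 2 * π * log (ρ ^ 2) := by
  have haverage := circleAverage_log_norm_sub_const_of_mem_closedBall
    (mem_closedBall_zero_iff.2 hv)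
  rw [circleAverage_def, smul_eq_mul, inv_mul_eq_iff_eq_mul₀ two_pi_pos.ne'] at haverage
  simp only [log_pow, intervalIntegral.integral_const_mul, haverage]
  ring

theorem integral_log_sub_cos_sub_sin {a x y : ℝ} (ha : 0 < a) (h : x ^ 2 + y ^ 2 ≤ a ^ 2) :
    ∫ φ in (0 : ℝ)..(2 * π), log (a - x * cos φ - y * sin φ) =
      2 * π * log ((a + √(a ^ 2 - (x ^ 2 + y ^ 2))) / 2) := by
  set w := √(a ^ 2 - (x ^ 2 + y ^ 2))
  have hw : w ^ 2 = a ^ 2 - (x ^ 2 + y ^ 2) := sq_sqrt (sub_nonneg.2 h)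
  have hw₀ : 0 ≤ w := sqrt_nonneg _
  -- The integrand is `‖ρ e^{iφ} - v‖ ^ 2` for the larger root `ρ ^ 2` of `4 X (a - X) = x² + y²`.
  obtain ⟨ρ, hρ, hρsq⟩ : ∃ ρ > 0, ρ ^ 2 = (a + w) / 2 :=
    ⟨√((a + w) / 2), by positivity, sq_sqrt (by positivity)⟩
  have hroot : 4 * ρ ^ 2 * (a - ρ ^ 2) = x ^ 2 + y ^ 2 := by
    rw [hρsq]
    linear_combination -hw
  let v : ℂ := ⟨x / (2 * ρ), y / (2 * ρ)⟩
  have hv : ‖v‖ ^ 2 = a - ρ ^ 2 := by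
    rw [← Complex.normSq_eq_norm_sq, Complex.normSq_apply]
    simp only [v]
    field_simp
    linear_combination -hroot
  have hvρ : ‖v‖ ≤ |ρ| := by
    rw [← abs_norm, ← sq_le_sq, hv, hρsq]
    linarith
  rw [← hρsq, ← integral_log_norm_circleMap_zero_sub_sq hvρ]
  refine intervalIntegral.integral_congr fun φ _ => congrArg log ?_
  rw [norm_circleMap_zero_sub_sq, hv]
  simp only [v]
  field_simp
  ring

theorem hasDerivAt_tanh (x : ℝ) : HasDerivAt tanh (1 - tanh x ^ 2) x := by
  have hcosh := (cosh_pos x).ne'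
  rw [tanh_eq_sinh_div_cosh, funext tanh_eq_sinh_div_cosh]
  exact ((hasDerivAt_sinh x).div (hasDerivAt_cosh x) hcosh).congr_deriv (by field_simp)

@[fun_prop]
theorem contDiff_tanh {n : WithTop ℕ∞} : ContDiff ℝ n tanh := by
  rw [funext tanh_eq_sinh_div_cosh]
  exact contDiff_sinh.div contDiff_cosh fun x => (cosh_pos x).ne'

theorem strictMono_tanh : StrictMono tanh :=
  strictMono_of_deriv_pos fun x => by
    rw [(hasDerivAt_tanh x).deriv]
    exact sub_pos.2 (tanh_sq_lt_one x)

theorem tanh_pos {x : ℝ} (hx : 0 < x) : 0 < tanh x := by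
  simpa using strictMono_tanh hx

theorem tanh_nonneg {x : ℝ} (hx : 0 ≤ x) : 0 ≤ tanh x := by
  simpa using strictMono_tanh.monotone hx

theorem tendsto_tanh_atTop : Tendsto tanh atTop (𝓝 1) :=
  tendsto_atTop_isLUB strictMono_tanh.monotone <| by
    rw [← image_univ, tanh_bijOn.image_eq]
    exact isLUB_Ioo (by norm_num)

theorem log_one_add_tanh_sub_log_one_sub_tanh (x : ℝ) :
    log (1 + tanh x) - log (1 - tanh x) = 2 * x := by
  have hlt := tanh_lt_one x
  have hgt := neg_one_lt_tanh x
  have hartanh := artanh_tanh x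
  rw [artanh_eq_half_log ⟨hgt.le, hlt.le⟩,
    log_div (neg_lt_iff_pos_add'.1 hgt).ne' (sub_pos.2 hlt).ne'] at hartanh
  linarith

end Analysis

section Germs

variable {𝕜 F : Type*} [NontriviallyNormedField 𝕜] [NormedAddCommGroup F] [NormedSpace 𝕜 F]

theorem eventuallyEq_deriv_nhdsWithin {f g : 𝕜 → F} {s : Set 𝕜} {c : 𝕜} (hs : IsOpen s)
    (h : f =ᶠ[𝓝[s] c] g) : deriv f =ᶠ[𝓝[s] c] deriv g := by
  filter_upwards [eventually_eventually_nhdsWithin.2 h, self_mem_nhdsWithin] with x hx hxs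
  rw [hs.nhdsWithin_eq hxs] at hx
  exact EventuallyEq.deriv_eq hx

theorem contDiffAt_deriv {f : 𝕜 → F} {c : 𝕜} {m n : WithTop ℕ∞} (hf : ContDiffAt 𝕜 n f c)
    (hmn : m + 1 ≤ n) : ContDiffAt 𝕜 m (deriv f) c :=
  (hf.fderiv_right hmn).clm_apply contDiffAt_const

theorem tendsto_deriv_of_eventuallyEq {f g : 𝕜 → F} {s : Set 𝕜} {c : 𝕜} (hs : IsOpen s)
    (h : f =ᶠ[𝓝[s] c] g) (hg : ContDiffAt 𝕜 1 g c) :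
    Tendsto (deriv f) (𝓝[s] c) (𝓝 (deriv g c)) :=
  ((contDiffAt_deriv (m := 0) hg (by norm_num)).continuousAt.mono_left nhdsWithin_le_nhds).congr'
    (eventuallyEq_deriv_nhdsWithin hs h).symm

theorem tendsto_deriv_deriv_of_eventuallyEq {f g : 𝕜 → F} {s : Set 𝕜} {c : 𝕜} (hs : IsOpen s)
    (h : f =ᶠ[𝓝[s] c] g) (hg : ContDiffAt 𝕜 2 g c) :
    Tendsto (deriv (deriv f)) (𝓝[s] c) (𝓝 (deriv (deriv g) c)) :=
  tendsto_deriv_of_eventuallyEq hs (eventuallyEq_deriv_nhdsWithin hs h)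
    (contDiffAt_deriv hg (by norm_num))

theorem tendsto_comp_sub_sub_comp_add {E : Type*} [AddGroup E] [TopologicalSpace E]
    [ContinuousSub E] {g : ℝ → E} {c : ℝ} {a b : E} (hl : Tendsto g (𝓝[<] c) (𝓝 a))
    (hr : Tendsto g (𝓝[>] c) (𝓝 b)) :
    Tendsto (fun x => g (c - x) - g (c + x)) (𝓝[>] 0) (𝓝 (a - b)) := by
  refine (hl.comp (tendsto_nhdsWithin_iff.2 ⟨?_, ?_⟩)).sub
    (hr.comp (tendsto_nhdsWithin_iff.2 ⟨?_, ?_⟩))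
  · exact ((continuous_const.sub continuous_id).tendsto' 0 c (sub_zero c)).mono_left
      nhdsWithin_le_nhds
  · filter_upwards [self_mem_nhdsWithin] with x hx using sub_lt_self c hx
  · exact ((continuous_const.add continuous_id).tendsto' 0 c (add_zero c)).mono_left
      nhdsWithin_le_nhds
  · filter_upwards [self_mem_nhdsWithin] with x hx using lt_add_of_pos_right c hx

theorem hasFirstOrderTransition_of_eventuallyEq {f U V : ℝ → ℝ} {c : ℝ}
    (hU : f =ᶠ[𝓝[≤] c] U) (hV : f =ᶠ[𝓝[≥] c] V) (hUd : DifferentiableAt ℝ U c)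
    (hVd : DifferentiableAt ℝ V c) (hne : deriv U c ≠ deriv V c) :
    HasFirstOrderTransition f c := by
  have hl : HasDerivWithinAt f (deriv U c) (Iic c) c :=
    hUd.hasDerivAt.hasDerivWithinAt.congr_of_eventuallyEq hU (hU.eq_of_nhdsWithin self_mem_Iic)
  have hr : HasDerivWithinAt f (deriv V c) (Ici c) c :=
    hVd.hasDerivAt.hasDerivWithinAt.congr_of_eventuallyEq hV (hV.eq_of_nhdsWithin self_mem_Ici)
  exact ⟨continuousAt_iff_continuous_left_right.2 ⟨hl.continuousWithinAt, hr.continuousWithinAt⟩,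
    _, _, hl.mono Iio_subset_Iic_self, hr.mono Ioi_subset_Ici_self, hne⟩

theorem not_hasFirstOrderTransition_of_differentiableAt {f : ℝ → ℝ} {c : ℝ}
    (hf : DifferentiableAt ℝ f c) : ¬ HasFirstOrderTransition f c := by
  rintro ⟨-, l, r, hl, hr, hlr⟩
  have hderiv {s : Set ℝ} := hf.hasDerivAt.hasDerivWithinAt (s := s)
  exact hlr (((uniqueDiffWithinAt_Iio c).eq_deriv _ hl hderiv).trans
    ((uniqueDiffWithinAt_Ioi c).eq_deriv _ hderiv hr))

end Germs

section Weights

variable {Λ : Lattice} {J : Couplings} {η : ℝ} {n : WithTop ℕ∞}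

theorem J₁_pos (hJ : J.Ferromagnetic Λ) : 0 < J.J₁ := by
  cases Λ <;> exact hJ.1

theorem J₂_pos (hJ : J.Ferromagnetic Λ) : 0 < J.J₂ := by
  cases Λ <;> exact hJ.2.1

theorem J₃_nonneg (hJ : J.Ferromagnetic Λ) : 0 ≤ J.J₃ := by
  cases Λ
  exacts [hJ.2.2.le, hJ.2.2.ge, hJ.2.2.le]

theorem Jref_pos (hJ : J.Ferromagnetic Λ) : 0 < Jref Λ J := by
  cases Λ
  exacts [J₁_pos hJ, J₁_pos hJ, J₂_pos hJ]

theorem t₁_pos (hJ : J.Ferromagnetic Λ) (hη : 0 < η) : 0 < t₁ Λ J η :=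
  tanh_pos (mul_pos (div_pos (J₁_pos hJ) (Jref_pos hJ)) hη)

theorem t₂_pos (hJ : J.Ferromagnetic Λ) (hη : 0 < η) : 0 < t₂ Λ J η :=
  tanh_pos (mul_pos (div_pos (J₂_pos hJ) (Jref_pos hJ)) hη)

theorem t₃_nonneg (hJ : J.Ferromagnetic Λ) (hη : 0 < η) : 0 ≤ t₃ Λ J η :=
  tanh_nonneg (mul_nonneg (div_nonneg (J₃_nonneg hJ) (Jref_pos hJ).le) hη.le)

theorem t₃_pos_of_hexagonal (hJ : J.Ferromagnetic .hexagonal) (hη : 0 < η) :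
    0 < t₃ .hexagonal J η :=
  tanh_pos (mul_pos (div_pos hJ.2.2 (Jref_pos hJ)) hη)

theorem t₁_lt_one : t₁ Λ J η < 1 := tanh_lt_one _

theorem t₂_lt_one : t₂ Λ J η < 1 := tanh_lt_one _

theorem t₃_lt_one : t₃ Λ J η < 1 := tanh_lt_one _

theorem one_sub_t₁_sq_pos : 0 < 1 - t₁ Λ J η ^ 2 := sub_pos.2 (tanh_sq_lt_one _)

theorem one_sub_t₂_sq_pos : 0 < 1 - t₂ Λ J η ^ 2 := sub_pos.2 (tanh_sq_lt_one _)

theorem one_sub_t₃_sq_pos : 0 < 1 - t₃ Λ J η ^ 2 := sub_pos.2 (tanh_sq_lt_one _)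

theorem hasDerivAt_tanh_const_mul (r x : ℝ) :
    HasDerivAt (fun x => tanh (r * x)) (r * (1 - tanh (r * x) ^ 2)) x :=
  ((hasDerivAt_tanh (r * x)).comp x (hasDerivAt_const_mul r)).congr_deriv (mul_comm _ _)

theorem hasDerivAt_t₁ : HasDerivAt (t₁ Λ J) (J.J₁ / Jref Λ J * (1 - t₁ Λ J η ^ 2)) η :=
  hasDerivAt_tanh_const_mul _ _

theorem hasDerivAt_t₂ : HasDerivAt (t₂ Λ J) (J.J₂ / Jref Λ J * (1 - t₂ Λ J η ^ 2)) η :=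
  hasDerivAt_tanh_const_mul _ _

theorem hasDerivAt_t₃ : HasDerivAt (t₃ Λ J) (J.J₃ / Jref Λ J * (1 - t₃ Λ J η ^ 2)) η :=
  hasDerivAt_tanh_const_mul _ _

theorem tendsto_t₁_atTop (hJ : J.Ferromagnetic Λ) : Tendsto (t₁ Λ J) atTop (𝓝 1) :=
  tendsto_tanh_atTop.comp (tendsto_id.const_mul_atTop (div_pos (J₁_pos hJ) (Jref_pos hJ)))

theorem tendsto_t₂_atTop (hJ : J.Ferromagnetic Λ) : Tendsto (t₂ Λ J) atTop (𝓝 1) :=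
  tendsto_tanh_atTop.comp (tendsto_id.const_mul_atTop (div_pos (J₂_pos hJ) (Jref_pos hJ)))

theorem tendsto_t₃_atTop_of_hexagonal (hJ : J.Ferromagnetic .hexagonal) :
    Tendsto (t₃ .hexagonal J) atTop (𝓝 1) :=
  tendsto_tanh_atTop.comp (tendsto_id.const_mul_atTop (div_pos hJ.2.2 (Jref_pos hJ)))

@[fun_prop]
theorem contDiff_t₁ : ContDiff ℝ n (t₁ Λ J) := by
  unfold t₁ η₁; fun_prop

@[fun_prop]
theorem contDiff_t₂ : ContDiff ℝ n (t₂ Λ J) := by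
  unfold t₂ η₂; fun_prop

@[fun_prop]
theorem contDiff_t₃ : ContDiff ℝ n (t₃ Λ J) := by
  unfold t₃ η₃; fun_prop

@[fun_prop]
theorem contDiff_α₀ : ContDiff ℝ n (α₀ Λ J) := by
  cases Λ <;> unfold α₀ <;> fun_prop

@[fun_prop]
theorem contDiff_α₁ : ContDiff ℝ n (α₁ Λ J) := by
  cases Λ <;> unfold α₁ <;> fun_prop

@[fun_prop]
theorem contDiff_α₂ : ContDiff ℝ n (α₂ Λ J) := by
  cases Λ <;> unfold α₂ <;> fun_prop

@[fun_prop]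
theorem contDiff_α₃ : ContDiff ℝ n (α₃ Λ J) := by
  cases Λ <;> unfold α₃ <;> fun_prop

@[fun_prop]
theorem contDiff_A₀ : ContDiff ℝ n (A₀ Λ J) := by
  unfold A₀; fun_prop

@[fun_prop]
theorem contDiff_A₁ : ContDiff ℝ n (A₁ Λ J) := by
  unfold A₁; fun_prop

@[fun_prop]
theorem contDiff_A₂ : ContDiff ℝ n (A₂ Λ J) := by
  unfold A₂; fun_prop

@[fun_prop]
theorem contDiff_A₃ : ContDiff ℝ n (A₃ Λ J) := by
  unfold A₃; fun_prop

theorem A₁_of_ne_hexagonal (hΛ : Λ ≠ .hexagonal) :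
    A₁ Λ J η = 2 * (t₁ Λ J η * (1 - t₂ Λ J η ^ 2) * (1 - t₃ Λ J η ^ 2)) := by
  cases Λ <;> first | contradiction | (simp only [A₁, α₀, α₁, α₂, α₃]; ring)

theorem A₁_hexagonal : A₁ .hexagonal J η =
    2 * (t₃ .hexagonal J η * t₁ .hexagonal J η * (1 - t₂ .hexagonal J η ^ 2)) := by
  simp only [A₁, α₀, α₁, α₂, α₃]; ring

theorem A₂_of_ne_hexagonal (hΛ : Λ ≠ .hexagonal) :
    A₂ Λ J η = 2 * (t₂ Λ J η * (1 - t₃ Λ J η ^ 2) * (1 - t₁ Λ J η ^ 2)) := by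
  cases Λ <;> first | contradiction | (simp only [A₂, α₀, α₁, α₂, α₃]; ring)

theorem A₂_hexagonal : A₂ .hexagonal J η =
    2 * (t₂ .hexagonal J η * t₃ .hexagonal J η * (1 - t₁ .hexagonal J η ^ 2)) := by
  simp only [A₂, α₀, α₁, α₂, α₃]; ring

theorem A₃_of_ne_hexagonal (hΛ : Λ ≠ .hexagonal) :
    A₃ Λ J η = 2 * (t₃ Λ J η * (1 - t₁ Λ J η ^ 2) * (1 - t₂ Λ J η ^ 2)) := by
  cases Λ <;> first | contradiction | (simp only [A₃, α₀, α₁, α₂, α₃]; ring)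

theorem A₃_hexagonal : A₃ .hexagonal J η =
    2 * (t₁ .hexagonal J η * t₂ .hexagonal J η * (1 - t₃ .hexagonal J η ^ 2)) := by
  simp only [A₃, α₀, α₁, α₂, α₃]; ring

theorem A₁_pos (hJ : J.Ferromagnetic Λ) (hη : 0 < η) : 0 < A₁ Λ J η := by
  have h₁ := t₁_pos hJ hη
  have h₂ := one_sub_t₂_sq_pos (Λ := Λ) (J := J) (η := η)
  have h₃ := one_sub_t₃_sq_pos (Λ := Λ) (J := J) (η := η)
  rcases eq_or_ne Λ .hexagonal with rfl | hΛ
  · have := t₃_pos_of_hexagonal hJ hη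
    rw [A₁_hexagonal]
    positivity
  · rw [A₁_of_ne_hexagonal hΛ]
    positivity

theorem A₂_pos (hJ : J.Ferromagnetic Λ) (hη : 0 < η) : 0 < A₂ Λ J η := by
  have h₂ := t₂_pos hJ hη
  have h₁ := one_sub_t₁_sq_pos (Λ := Λ) (J := J) (η := η)
  have h₃ := one_sub_t₃_sq_pos (Λ := Λ) (J := J) (η := η)
  rcases eq_or_ne Λ .hexagonal with rfl | hΛ
  · have := t₃_pos_of_hexagonal hJ hη
    rw [A₂_hexagonal]
    positivity
  · rw [A₂_of_ne_hexagonal hΛ]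
    positivity

theorem A₃_nonneg (hJ : J.Ferromagnetic Λ) (hη : 0 < η) : 0 ≤ A₃ Λ J η := by
  have h₃ := t₃_nonneg hJ hη
  have h₁ := one_sub_t₁_sq_pos (Λ := Λ) (J := J) (η := η)
  have h₂ := one_sub_t₂_sq_pos (Λ := Λ) (J := J) (η := η)
  rcases eq_or_ne Λ .hexagonal with rfl | hΛ
  · have := t₁_pos hJ hη
    have := t₂_pos hJ hη
    have := one_sub_t₃_sq_pos (Λ := .hexagonal) (J := J) (η := η)
    rw [A₃_hexagonal]
    positivity
  · rw [A₃_of_ne_hexagonal hΛ]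
    positivity

end Weights

section Branches

variable {Λ : Lattice} {J : Couplings} {η : ℝ} {n : WithTop ℕ∞}

/-- The larger of the two branches of the zero mode above the critical temperature. The argument of
the logarithm in the zero mode is `‖hotBranch - coldBranch * e^{iφ}‖ ^ 2`. -/
noncomputable def hotBranch (Λ : Lattice) (J : Couplings) (η : ℝ) : ℝ := α₀ Λ J η - α₁ Λ J η

/-- The larger of the two branches of the zero mode below the critical temperature. -/
noncomputable def coldBranch (Λ : Lattice) (J : Couplings) (η : ℝ) : ℝ := α₂ Λ J η + α₃ Λ J η

@[fun_prop]
theorem contDiff_hotBranch : ContDiff ℝ n (hotBranch Λ J) := by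
  unfold hotBranch; fun_prop

@[fun_prop]
theorem contDiff_coldBranch : ContDiff ℝ n (coldBranch Λ J) := by
  unfold coldBranch; fun_prop

theorem A₀_sub_A₁ : A₀ Λ J η - A₁ Λ J η = hotBranch Λ J η ^ 2 + coldBranch Λ J η ^ 2 := by
  unfold A₀ A₁ hotBranch coldBranch; ring

theorem A₂_add_A₃ : A₂ Λ J η + A₃ Λ J η = 2 * hotBranch Λ J η * coldBranch Λ J η := by
  unfold A₂ A₃ hotBranch coldBranch; ring

theorem hotBranch_of_ne_hexagonal (hΛ : Λ ≠ .hexagonal) :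
    hotBranch Λ J η = (1 - t₁ Λ J η) * (1 - t₂ Λ J η * t₃ Λ J η) := by
  cases Λ <;> first | contradiction | (simp only [hotBranch, α₀, α₁]; ring)

theorem hotBranch_hexagonal :
    hotBranch .hexagonal J η = 1 - t₁ .hexagonal J η * t₃ .hexagonal J η := by
  simp only [hotBranch, α₀, α₁, mul_comm]

theorem coldBranch_of_ne_hexagonal (hΛ : Λ ≠ .hexagonal) :
    coldBranch Λ J η = (1 + t₁ Λ J η) * (t₃ Λ J η + t₂ Λ J η) := by
  cases Λ <;> first | contradiction | (simp only [coldBranch, α₂, α₃]; ring)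

theorem coldBranch_hexagonal :
    coldBranch .hexagonal J η = t₂ .hexagonal J η * (t₃ .hexagonal J η + t₁ .hexagonal J η) := by
  simp only [coldBranch, α₂, α₃]; ring

theorem one_sub_mul_pos {x y : ℝ} (hy : 0 ≤ y) (hx₁ : x < 1) (hy₁ : y < 1) : 0 < 1 - x * y := by
  linarith [mul_le_of_le_one_left hy hx₁.le]

theorem hotBranch_pos (hJ : J.Ferromagnetic Λ) (hη : 0 < η) : 0 < hotBranch Λ J η := by
  rcases eq_or_ne Λ .hexagonal with rfl | hΛ
  · rw [hotBranch_hexagonal]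
    exact one_sub_mul_pos (t₃_nonneg hJ hη) t₁_lt_one t₃_lt_one
  · rw [hotBranch_of_ne_hexagonal hΛ]
    exact mul_pos (sub_pos.2 t₁_lt_one) (one_sub_mul_pos (t₃_nonneg hJ hη) t₂_lt_one t₃_lt_one)

theorem coldBranch_pos (hJ : J.Ferromagnetic Λ) (hη : 0 < η) : 0 < coldBranch Λ J η := by
  have h₁ := t₁_pos hJ hη
  have h₂ := t₂_pos hJ hη
  have h₃ := t₃_nonneg hJ hη
  rcases eq_or_ne Λ .hexagonal with rfl | hΛ
  · rw [coldBranch_hexagonal]; positivity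
  · rw [coldBranch_of_ne_hexagonal hΛ]; positivity

theorem coldBranch_zero_lt_hotBranch_zero : coldBranch Λ J 0 < hotBranch Λ J 0 := by
  cases Λ <;> simp [coldBranch, hotBranch, α₀, α₁, α₂, α₃, t₁, t₂, t₃, η₁, η₂, η₃]

theorem eventually_hotBranch_lt_coldBranch (hJ : J.Ferromagnetic Λ) :
    ∀ᶠ η in atTop, hotBranch Λ J η < coldBranch Λ J η := by
  have h₁ := tendsto_t₁_atTop hJ
  have h₂ := tendsto_t₂_atTop hJ
  rcases eq_or_ne Λ .hexagonal with rfl | hΛ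
  · have h₃ := tendsto_t₃_atTop_of_hexagonal hJ
    simp only [hotBranch_hexagonal, coldBranch_hexagonal]
    exact ((h₁.mul h₃).const_sub 1).eventually_lt (h₂.mul (h₃.add h₁)) (by norm_num)
  · filter_upwards [(h₁.const_sub 1).eventually_lt h₂ (by norm_num), eventually_gt_atTop 0]
      with η hlt hη
    have ht₁ := t₁_pos hJ hη
    have ht₂ := t₂_pos hJ hη
    have ht₃ := t₃_nonneg hJ hη
    calc hotBranch Λ J η ≤ 1 - t₁ Λ J η := by
          rw [hotBranch_of_ne_hexagonal hΛ]
          exact mul_le_of_le_one_right (sub_pos.2 t₁_lt_one).le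
            (sub_le_self 1 (mul_nonneg ht₂.le ht₃))
      _ < t₂ Λ J η := hlt
      _ ≤ coldBranch Λ J η := by
          rw [coldBranch_of_ne_hexagonal hΛ]
          nlinarith

end Branches

section Amplitudes

variable {Λ : Lattice} {J : Couplings} {η : ℝ}

/-- The logarithmic derivative of `(t + u) / (1 - u * t)` when `t` and `u` are the weights of two
bonds with relative couplings `r` and `q`, so that `t' = r * (1 - t ^ 2)` and
`u' = q * (1 - u ^ 2)`. It is the part of the amplitude `aε` due to these two bonds. -/
noncomputable def pairRate (r q t u : ℝ) : ℝ :=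
  r * ((1 - t ^ 2) * (1 + u ^ 2) / ((t + u) * (1 - u * t)))
    + q * ((1 + t ^ 2) * (1 - u ^ 2) / ((t + u) * (1 - u * t)))

/-- The derivative of `-pairRate r q t u` when `t' = r * (1 - t ^ 2)` and `u' = q * (1 - u ^ 2)`.
It is the part of the amplitude `ac / η ^ 2` due to the two bonds. -/
noncomputable def pairCurvature (r q t u : ℝ) : ℝ :=
  (r - q) ^ 2 * ((1 - t ^ 4) * (1 - u ^ 4) / ((t + u) ^ 2 * (1 - u * t) ^ 2))
    + 4 * r * q * ((1 - t ^ 2) * (1 - u ^ 2) / (t + u) ^ 2)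

section Pair

variable {r q : ℝ}

theorem one_sub_pow_pos {x : ℝ} {k : ℕ} (hk : k ≠ 0) (hx₀ : 0 ≤ x) (hx₁ : x < 1) :
    0 < 1 - x ^ k :=
  sub_pos.2 (pow_lt_one₀ hx₀ hx₁ hk)

theorem pairRate_pos {t u : ℝ} (hr : 0 ≤ r) (hq : 0 < q) (ht₀ : 0 ≤ t) (ht₁ : t < 1) (hu₀ : 0 < u)
    (hu₁ : u < 1) : 0 < pairRate r q t u := by
  have ht := one_sub_pow_pos two_ne_zero ht₀ ht₁
  have hu := one_sub_pow_pos two_ne_zero hu₀.le hu₁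
  have htu := one_sub_mul_pos ht₀ hu₁ ht₁
  unfold pairRate
  positivity

theorem pairCurvature_pos {t u : ℝ} (hr : 0 ≤ r) (hq : 0 < q) (ht₀ : 0 ≤ t) (ht₁ : t < 1)
    (hu₀ : 0 < u) (hu₁ : u < 1) : 0 < pairCurvature r q t u := by
  have ht := one_sub_pow_pos two_ne_zero ht₀ ht₁
  have hu := one_sub_pow_pos two_ne_zero hu₀.le hu₁
  have ht₄ := one_sub_pow_pos four_ne_zero ht₀ ht₁
  have hu₄ := one_sub_pow_pos four_ne_zero hu₀.le hu₁
  have htu := one_sub_mul_pos ht₀ hu₁ ht₁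
  unfold pairCurvature
  rcases hr.eq_or_lt with rfl | hr
  · rw [zero_sub, neg_sq]
    positivity
  · positivity

variable {t u : ℝ → ℝ}

theorem hasDerivAt_log_add_sub_log_one_sub_mul (ht : HasDerivAt t (r * (1 - t η ^ 2)) η)
    (hu : HasDerivAt u (q * (1 - u η ^ 2)) η) (hadd : t η + u η ≠ 0) (hsub : 1 - u η * t η ≠ 0) :
    HasDerivAt (fun x => log (t x + u x) - log (1 - u x * t x)) (pairRate r q (t η) (u η)) η := by
  refine (((ht.add hu).log hadd).sub (((hu.mul ht).const_sub 1).log hsub)).congr_deriv ?_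
  have hsub' : 1 - t η * u η ≠ 0 := by rwa [mul_comm]
  simp only [pairRate, Pi.add_apply, Pi.mul_apply]
  field_simp
  ring

theorem hasDerivAt_pairRate (ht : HasDerivAt t (r * (1 - t η ^ 2)) η)
    (hu : HasDerivAt u (q * (1 - u η ^ 2)) η) (hadd : t η + u η ≠ 0) (hsub : 1 - u η * t η ≠ 0) :
    HasDerivAt (fun x => pairRate r q (t x) (u x)) (-pairCurvature r q (t η) (u η)) η := by
  have hden := (ht.add hu).mul ((hu.mul ht).const_sub 1)
  have hden₀ : (t η + u η) * (1 - u η * t η) ≠ 0 := mul_ne_zero hadd hsub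
  have hr := ((((ht.pow 2).const_sub 1).mul ((hu.pow 2).const_add 1)).div hden hden₀).const_mul r
  have hq := ((((ht.pow 2).const_add 1).mul ((hu.pow 2).const_sub 1)).div hden hden₀).const_mul q
  refine (hr.add hq).congr_deriv ?_
  have hsub' : 1 - t η * u η ≠ 0 := by rwa [mul_comm]
  simp only [pairCurvature, Pi.add_apply, Pi.mul_apply, Pi.pow_apply]
  field_simp
  ring

theorem hasDerivAt_one_sub_sq_div (ht : HasDerivAt t (1 - t η ^ 2) η) (h : t η ≠ 0) :
    HasDerivAt (fun x => (1 - t x ^ 2) / t x) (-((1 - t η ^ 4) / t η ^ 2)) η := by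
  refine (((ht.pow 2).const_sub 1).div ht h).congr_deriv ?_
  simp only [Pi.pow_apply]
  field_simp
  ring

end Pair

theorem aε_of_ne_hexagonal (hΛ : Λ ≠ .hexagonal) : aε Λ J η =
    2 + pairRate (J.J₃ / Jref Λ J) (J.J₂ / Jref Λ J) (t₃ Λ J η) (t₂ Λ J η) := by
  cases Λ <;> first | contradiction | (simp only [aε, pairRate, Jref]; ring)

theorem aε_hexagonal : aε .hexagonal J η =
    pairRate (J.J₃ / J.J₂) (J.J₁ / J.J₂) (t₃ .hexagonal J η) (t₁ .hexagonal J η)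
      + (1 - t₂ .hexagonal J η ^ 2) / t₂ .hexagonal J η := by
  simp only [aε, pairRate]; ring

theorem ac_of_ne_hexagonal (hΛ : Λ ≠ .hexagonal) : ac Λ J η =
    η ^ 2 * pairCurvature (J.J₃ / Jref Λ J) (J.J₂ / Jref Λ J) (t₃ Λ J η) (t₂ Λ J η) := by
  cases Λ <;> first | contradiction | simp only [ac, pairCurvature, Jref]

theorem ac_hexagonal : ac .hexagonal J η =
    η ^ 2 * (pairCurvature (J.J₃ / J.J₂) (J.J₁ / J.J₂) (t₃ .hexagonal J η) (t₁ .hexagonal J η)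
      + (1 - t₂ .hexagonal J η ^ 4) / t₂ .hexagonal J η ^ 2) := by
  simp only [ac, pairCurvature]

theorem aε_pos (hJ : J.Ferromagnetic Λ) (hη : 0 < η) : 0 < aε Λ J η := by
  have hr₁ := div_pos (J₁_pos hJ) (Jref_pos hJ)
  have hr₂ := div_pos (J₂_pos hJ) (Jref_pos hJ)
  have hr₃ := div_nonneg (J₃_nonneg hJ) (Jref_pos hJ).le
  have ht₃ := t₃_nonneg hJ hη
  rcases eq_or_ne Λ .hexagonal with rfl | hΛ
  · rw [aε_hexagonal]
    exact add_pos (pairRate_pos hr₃ hr₁ ht₃ t₃_lt_one (t₁_pos hJ hη) t₁_lt_one)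
      (div_pos one_sub_t₂_sq_pos (t₂_pos hJ hη))
  · rw [aε_of_ne_hexagonal hΛ]
    exact add_pos two_pos (pairRate_pos hr₃ hr₂ ht₃ t₃_lt_one (t₂_pos hJ hη) t₂_lt_one)

theorem ac_pos (hJ : J.Ferromagnetic Λ) (hη : 0 < η) : 0 < ac Λ J η := by
  have hr₁ := div_pos (J₁_pos hJ) (Jref_pos hJ)
  have hr₂ := div_pos (J₂_pos hJ) (Jref_pos hJ)
  have hr₃ := div_nonneg (J₃_nonneg hJ) (Jref_pos hJ).le
  have ht₃ := t₃_nonneg hJ hη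
  have ht₂ := t₂_pos hJ hη
  rcases eq_or_ne Λ .hexagonal with rfl | hΛ
  · rw [ac_hexagonal]
    exact mul_pos (pow_pos hη 2) (add_pos
      (pairCurvature_pos hr₃ hr₁ ht₃ t₃_lt_one (t₁_pos hJ hη) t₁_lt_one)
      (div_pos (one_sub_pow_pos four_ne_zero ht₂.le t₂_lt_one) (pow_pos ht₂ 2)))
  · rw [ac_of_ne_hexagonal hΛ]
    exact mul_pos (pow_pos hη 2) (pairCurvature_pos hr₃ hr₂ ht₃ t₃_lt_one ht₂ t₂_lt_one)

end Amplitudes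

section LogRatio

variable {Λ : Lattice} {J : Couplings} {η ηc : ℝ}

/-- The logarithm of `coldBranch / hotBranch`. It increases strictly with `η` and vanishes exactly
at the critical point. -/
noncomputable def logRatio (Λ : Lattice) (J : Couplings) (η : ℝ) : ℝ :=
  log (coldBranch Λ J η) - log (hotBranch Λ J η)

theorem t₃_add_t₁_pos (hJ : J.Ferromagnetic Λ) (hη : 0 < η) : 0 < t₃ Λ J η + t₁ Λ J η :=
  add_pos_of_nonneg_of_pos (t₃_nonneg hJ hη) (t₁_pos hJ hη)

theorem t₃_add_t₂_pos (hJ : J.Ferromagnetic Λ) (hη : 0 < η) : 0 < t₃ Λ J η + t₂ Λ J η :=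
  add_pos_of_nonneg_of_pos (t₃_nonneg hJ hη) (t₂_pos hJ hη)

theorem one_sub_t₁_mul_t₃_pos (hJ : J.Ferromagnetic Λ) (hη : 0 < η) :
    0 < 1 - t₁ Λ J η * t₃ Λ J η :=
  one_sub_mul_pos (t₃_nonneg hJ hη) t₁_lt_one t₃_lt_one

theorem one_sub_t₂_mul_t₃_pos (hJ : J.Ferromagnetic Λ) (hη : 0 < η) :
    0 < 1 - t₂ Λ J η * t₃ Λ J η :=
  one_sub_mul_pos (t₃_nonneg hJ hη) t₂_lt_one t₃_lt_one

theorem logRatio_of_ne_hexagonal (hJ : J.Ferromagnetic Λ) (hΛ : Λ ≠ .hexagonal) (hη : 0 < η) :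
    logRatio Λ J η =
      2 * η + (log (t₃ Λ J η + t₂ Λ J η) - log (1 - t₂ Λ J η * t₃ Λ J η)) := by
  have hη₁ : η₁ Λ J η = η := by
    have hJ₁ := (J₁_pos hJ).ne'
    cases Λ <;> first | contradiction | (simp only [η₁, Jref]; field_simp)
  have htwo := log_one_add_tanh_sub_log_one_sub_tanh (η₁ Λ J η)
  rw [logRatio, coldBranch_of_ne_hexagonal hΛ, hotBranch_of_ne_hexagonal hΛ,
    log_mul (add_pos one_pos (t₁_pos hJ hη)).ne' (t₃_add_t₂_pos hJ hη).ne',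
    log_mul (sub_pos.2 t₁_lt_one).ne' (one_sub_t₂_mul_t₃_pos hJ hη).ne', t₁]
  linear_combination htwo + 2 * hη₁

theorem logRatio_hexagonal (hJ : J.Ferromagnetic .hexagonal) (hη : 0 < η) :
    logRatio .hexagonal J η =
      log (t₃ .hexagonal J η + t₁ .hexagonal J η)
        - log (1 - t₁ .hexagonal J η * t₃ .hexagonal J η) + log (t₂ .hexagonal J η) := by
  rw [logRatio, coldBranch_hexagonal, hotBranch_hexagonal,
    log_mul (t₂_pos hJ hη).ne' (t₃_add_t₁_pos hJ hη).ne']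
  ring

theorem hasDerivAt_t₂_hexagonal (hJ : J.Ferromagnetic .hexagonal) :
    HasDerivAt (t₂ .hexagonal J) (1 - t₂ .hexagonal J η ^ 2) η :=
  hasDerivAt_t₂.congr_deriv (by rw [Jref, div_self (J₂_pos hJ).ne', one_mul])

theorem hasDerivAt_logRatio (hJ : J.Ferromagnetic Λ) (hη : 0 < η) :
    HasDerivAt (logRatio Λ J) (aε Λ J η) η := by
  have hpos : ∀ᶠ x in 𝓝 η, 0 < x := Ioi_mem_nhds hη
  rcases eq_or_ne Λ .hexagonal with rfl | hΛ
  · rw [aε_hexagonal]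
    exact ((hasDerivAt_log_add_sub_log_one_sub_mul hasDerivAt_t₃ hasDerivAt_t₁
        (t₃_add_t₁_pos hJ hη).ne' (one_sub_t₁_mul_t₃_pos hJ hη).ne').add
      ((hasDerivAt_t₂_hexagonal hJ).log (t₂_pos hJ hη).ne')).congr_of_eventuallyEq
        (hpos.mono fun x hx => logRatio_hexagonal hJ hx)
  · rw [aε_of_ne_hexagonal hΛ]
    exact ((hasDerivAt_const_mul 2).add (hasDerivAt_log_add_sub_log_one_sub_mul hasDerivAt_t₃
        hasDerivAt_t₂ (t₃_add_t₂_pos hJ hη).ne'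
        (one_sub_t₂_mul_t₃_pos hJ hη).ne')).congr_of_eventuallyEq
      (hpos.mono fun x hx => logRatio_of_ne_hexagonal hJ hΛ hx)

theorem hasDerivAt_aε (hJ : J.Ferromagnetic Λ) (hη : 0 < η) :
    HasDerivAt (aε Λ J) (-(ac Λ J η / η ^ 2)) η := by
  have hη₂ : η ^ 2 ≠ 0 := pow_ne_zero 2 hη.ne'
  rcases eq_or_ne Λ .hexagonal with rfl | hΛ
  · rw [ac_hexagonal, mul_div_cancel_left₀ _ hη₂, neg_add]
    exact ((hasDerivAt_pairRate hasDerivAt_t₃ hasDerivAt_t₁ (t₃_add_t₁_pos hJ hη).ne'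
        (one_sub_t₁_mul_t₃_pos hJ hη).ne').add
      (hasDerivAt_one_sub_sq_div (hasDerivAt_t₂_hexagonal hJ)
        (t₂_pos hJ hη).ne')).congr_of_eventuallyEq (.of_forall fun _ => aε_hexagonal)
  · rw [ac_of_ne_hexagonal hΛ, mul_div_cancel_left₀ _ hη₂]
    exact ((hasDerivAt_pairRate hasDerivAt_t₃ hasDerivAt_t₂ (t₃_add_t₂_pos hJ hη).ne'
        (one_sub_t₂_mul_t₃_pos hJ hη).ne').const_add 2).congr_of_eventuallyEq
      (.of_forall fun _ => aε_of_ne_hexagonal hΛ)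

theorem contDiffOn_logRatio {n : WithTop ℕ∞} (hJ : J.Ferromagnetic Λ) :
    ContDiffOn ℝ n (logRatio Λ J) (Ioi 0) :=
  (contDiff_coldBranch.contDiffOn.log fun _ hη => (coldBranch_pos hJ hη).ne').sub
    (contDiff_hotBranch.contDiffOn.log fun _ hη => (hotBranch_pos hJ hη).ne')

theorem contDiffAt_aε {n : WithTop ℕ∞} (hJ : J.Ferromagnetic Λ) (hη : 0 < η) :
    ContDiffAt ℝ n (aε Λ J) η :=
  (contDiffAt_deriv ((contDiffOn_logRatio hJ).contDiffAt (Ioi_mem_nhds hη))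
    le_rfl).congr_of_eventuallyEq <| by
      filter_upwards [Ioi_mem_nhds hη] with x hx using (hasDerivAt_logRatio hJ hx).deriv.symm

theorem strictMonoOn_logRatio (hJ : J.Ferromagnetic Λ) : StrictMonoOn (logRatio Λ J) (Ioi 0) := by
  refine strictMonoOn_of_deriv_pos (convex_Ioi 0) (contDiffOn_logRatio (n := 0) hJ).continuousOn
    fun η hη => ?_
  rw [interior_Ioi] at hη
  rw [(hasDerivAt_logRatio hJ hη).deriv]
  exact aε_pos hJ hη

theorem isCritical_iff_hotBranch_eq_coldBranch :
    IsCritical Λ J η ↔ 0 < η ∧ hotBranch Λ J η = coldBranch Λ J η := by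
  have hsq : A₀ Λ J η - A₁ Λ J η - A₂ Λ J η - A₃ Λ J η =
      (hotBranch Λ J η - coldBranch Λ J η) ^ 2 := by
    linear_combination A₀_sub_A₁ (Λ := Λ) (J := J) (η := η)
      - A₂_add_A₃ (Λ := Λ) (J := J) (η := η)
  rw [IsCritical, hsq, sq_eq_zero_iff, sub_eq_zero]

theorem logRatio_eq_zero (hc : IsCritical Λ J ηc) : logRatio Λ J ηc = 0 := by
  rw [logRatio, (isCritical_iff_hotBranch_eq_coldBranch.1 hc).2, sub_self]

theorem logRatio_neg (hJ : J.Ferromagnetic Λ) (hc : IsCritical Λ J ηc) (hη : 0 < η) (h : η < ηc) :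
    logRatio Λ J η < 0 :=
  (strictMonoOn_logRatio hJ hη hc.1 h).trans_eq (logRatio_eq_zero hc)

theorem logRatio_pos (hJ : J.Ferromagnetic Λ) (hc : IsCritical Λ J ηc) (h : ηc < η) :
    0 < logRatio Λ J η :=
  (logRatio_eq_zero hc).symm.trans_lt (strictMonoOn_logRatio hJ hc.1 (hc.1.trans h) h)

theorem logRatio_nonpos (hJ : J.Ferromagnetic Λ) (hc : IsCritical Λ J ηc) (hη : 0 < η)
    (h : η ≤ ηc) : logRatio Λ J η ≤ 0 :=
  ((strictMonoOn_logRatio hJ).monotoneOn hη hc.1 h).trans_eq (logRatio_eq_zero hc)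

theorem logRatio_nonneg (hJ : J.Ferromagnetic Λ) (hc : IsCritical Λ J ηc) (h : ηc ≤ η) :
    0 ≤ logRatio Λ J η :=
  (logRatio_eq_zero hc).symm.trans_le
    ((strictMonoOn_logRatio hJ).monotoneOn hc.1 (hc.1.trans_le h) h)

theorem exists_isCritical (hJ : J.Ferromagnetic Λ) : ∃ ηc, IsCritical Λ J ηc := by
  obtain ⟨b, hb, hb₀⟩ :=
    ((eventually_hotBranch_lt_coldBranch hJ).and (eventually_gt_atTop 0)).exists
  have hcont : Continuous fun η => hotBranch Λ J η - coldBranch Λ J η :=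
    (contDiff_hotBranch (n := 0).sub contDiff_coldBranch).continuous
  obtain ⟨ηc, ⟨hηc, -⟩, hzero⟩ := intermediate_value_Ioo' hb₀.le hcont.continuousOn
    ⟨sub_neg.2 hb, sub_pos.2 coldBranch_zero_lt_hotBranch_zero⟩
  exact ⟨ηc, isCritical_iff_hotBranch_eq_coldBranch.2 ⟨hηc, sub_eq_zero.1 hzero⟩⟩

theorem existsUnique_isCritical (hJ : J.Ferromagnetic Λ) : ∃! ηc, IsCritical Λ J ηc :=
  existsUnique_of_exists_of_unique (exists_isCritical hJ) fun _ _ hc hc' =>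
    (strictMonoOn_logRatio hJ).injOn hc.1 hc'.1
      ((logRatio_eq_zero hc).trans (logRatio_eq_zero hc').symm)

end LogRatio

section Modes

variable {Λ : Lattice} {J : Couplings} {L : ℕ} {p η : ℝ} {n : WithTop ℕ∞}

/-- The mean over `φ` of the argument of the logarithm in `modeFreeEnergy`; it is also the
denominator of `G`. -/
noncomputable def modeMean (Λ : Lattice) (J : Couplings) (L : ℕ) (p η : ℝ) : ℝ :=
  A₀ Λ J η - A₁ Λ J η * cos (2 * π * p / L)

/-- The discriminant of the mode `p`: the squared mean of the argument of the logarithm minus the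
squared amplitude of its oscillation in `φ`. The mode is singular where it vanishes. -/
noncomputable def modeDisc (Λ : Lattice) (J : Couplings) (L : ℕ) (p η : ℝ) : ℝ :=
  modeMean Λ J L p η ^ 2 -
    (A₂ Λ J η ^ 2 + A₃ Λ J η ^ 2 + 2 * A₂ Λ J η * A₃ Λ J η * cos (2 * π * p / L))

@[fun_prop]
theorem contDiff_modeMean : ContDiff ℝ n (modeMean Λ J L p) := by
  unfold modeMean; fun_prop

@[fun_prop]
theorem contDiff_modeDisc : ContDiff ℝ n (modeDisc Λ J L p) := by
  unfold modeDisc; fun_prop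

theorem modeMean_sub_A₂_sub_A₃ : modeMean Λ J L p η - A₂ Λ J η - A₃ Λ J η =
    (hotBranch Λ J η - coldBranch Λ J η) ^ 2 + A₁ Λ J η * (1 - cos (2 * π * p / L)) := by
  rw [modeMean]
  linear_combination A₀_sub_A₁ (Λ := Λ) (J := J) (η := η) - A₂_add_A₃ (Λ := Λ) (J := J) (η := η)

theorem modeDisc_eq : modeDisc Λ J L p η =
    (modeMean Λ J L p η - A₂ Λ J η - A₃ Λ J η) * (modeMean Λ J L p η + A₂ Λ J η + A₃ Λ J η)
      + 2 * A₂ Λ J η * A₃ Λ J η * (1 - cos (2 * π * p / L)) := by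
  rw [modeDisc]
  ring

theorem one_sub_cos_nonneg (x : ℝ) : 0 ≤ 1 - cos x := sub_nonneg.2 (cos_le_one x)

theorem modeMean_sub_A₂_sub_A₃_nonneg (hJ : J.Ferromagnetic Λ) (hη : 0 < η) :
    0 ≤ modeMean Λ J L p η - A₂ Λ J η - A₃ Λ J η := by
  have hA₁ := A₁_pos hJ hη
  have hcos := one_sub_cos_nonneg (2 * π * p / L)
  rw [modeMean_sub_A₂_sub_A₃]
  positivity

theorem modeMean_pos (hJ : J.Ferromagnetic Λ) (hη : 0 < η) : 0 < modeMean Λ J L p η := by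
  linarith [A₂_pos hJ hη, A₃_nonneg hJ hη, modeMean_sub_A₂_sub_A₃_nonneg (L := L) (p := p) hJ hη]

theorem modeDisc_nonneg (hJ : J.Ferromagnetic Λ) (hη : 0 < η) : 0 ≤ modeDisc Λ J L p η := by
  have hmean := modeMean_pos (L := L) (p := p) hJ hη
  have hA₂ := A₂_pos hJ hη
  have hA₃ := A₃_nonneg hJ hη
  have hsub := modeMean_sub_A₂_sub_A₃_nonneg (L := L) (p := p) hJ hη
  have hcos := one_sub_cos_nonneg (2 * π * p / L)
  rw [modeDisc_eq]
  positivity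

theorem modeDisc_pos (hJ : J.Ferromagnetic Λ) (hη : 0 < η) (hp : cos (2 * π * p / L) ≠ 1) :
    0 < modeDisc Λ J L p η := by
  have hmean := modeMean_pos (L := L) (p := p) hJ hη
  have hA₁ := A₁_pos hJ hη
  have hA₂ := A₂_pos hJ hη
  have hA₃ := A₃_nonneg hJ hη
  have hcos : 0 < 1 - cos (2 * π * p / L) := sub_pos.2 ((cos_le_one _).lt_of_ne hp)
  rw [modeDisc_eq, modeMean_sub_A₂_sub_A₃]
  positivity

theorem modeFreeEnergy_eq (hJ : J.Ferromagnetic Λ) (hη : 0 < η) :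
    modeFreeEnergy Λ J L p η = -(1 / (2 * cellSites Λ * L)) *
      log ((modeMean Λ J L p η + √(modeDisc Λ J L p η)) / 2) := by
  set θ := 2 * π * p / L with hθ
  have hamplitude : (A₂ Λ J η + A₃ Λ J η * cos θ) ^ 2 + (A₃ Λ J η * sin θ) ^ 2 =
      A₂ Λ J η ^ 2 + A₃ Λ J η ^ 2 + 2 * A₂ Λ J η * A₃ Λ J η * cos θ := by
    linear_combination A₃ Λ J η ^ 2 * sin_sq_add_cos_sq θ
  have hdisc := modeDisc_nonneg (L := L) (p := p) hJ hη
  have hintegral := integral_log_sub_cos_sub_sin (modeMean_pos (L := L) (p := p) hJ hη)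
    (hamplitude.trans_le (sub_nonneg.1 hdisc))
  rw [hamplitude, ← modeDisc] at hintegral
  rw [modeFreeEnergy, ← mul_div_cancel_left₀ (log _) two_pi_pos.ne', ← hintegral]
  congr 2
  refine intervalIntegral.integral_congr fun φ _ => congrArg log ?_
  rw [modeMean, ← hθ, cos_sub]
  ring

theorem contDiffOn_modeFreeEnergy (hJ : J.Ferromagnetic Λ) (hp : cos (2 * π * p / L) ≠ 1) :
    ContDiffOn ℝ n (modeFreeEnergy Λ J L p) (Ioi 0) := by
  refine (contDiffOn_const.mul (ContDiffOn.log (.div_const (contDiff_modeMean.contDiffOn.add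
    (contDiff_modeDisc.contDiffOn.sqrt fun η hη => (modeDisc_pos hJ hη hp).ne')) 2)
      fun η hη => ?_)).congr fun η hη => modeFreeEnergy_eq hJ hη
  have hmean := modeMean_pos (L := L) (p := p) hJ hη
  positivity

theorem cos_two_pi_mul_div_eq_one_iff {x y : ℝ} (hy : y ≠ 0) :
    cos (2 * π * x / y) = 1 ↔ ∃ k : ℤ, x = k * y := by
  rw [cos_eq_one_iff]
  refine exists_congr fun k => ?_
  rw [mul_comm (k : ℝ), mul_div_assoc, mul_right_inj' two_pi_pos.ne', eq_comm, div_eq_iff hy]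

theorem contDiffOn_modeFreeEnergy_natCast (hJ : J.Ferromagnetic Λ) {k : ℕ} (hk : 0 < k)
    (hkL : k < L) : ContDiffOn ℝ n (modeFreeEnergy Λ J L k) (Ioi 0) := by
  refine contDiffOn_modeFreeEnergy hJ fun hcos => ?_
  have hL : (L : ℝ) ≠ 0 := Nat.cast_ne_zero.2 (hk.trans hkL).ne'
  obtain ⟨j, hj⟩ := (cos_two_pi_mul_div_eq_one_iff hL).1 hcos
  have hdvd : (L : ℤ) ∣ k := ⟨j, by rw [mul_comm]; exact_mod_cast hj⟩
  exact hkL.not_ge (Nat.le_of_dvd hk (Int.natCast_dvd_natCast.1 hdvd))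

theorem contDiffOn_modeFreeEnergy_natCast_add_half (hJ : J.Ferromagnetic Λ) (hL : 0 < L) (k : ℕ) :
    ContDiffOn ℝ n (modeFreeEnergy Λ J L (k + 1 / 2)) (Ioi 0) := by
  refine contDiffOn_modeFreeEnergy hJ fun hcos => ?_
  obtain ⟨j, hj⟩ := (cos_two_pi_mul_div_eq_one_iff (Nat.cast_ne_zero.2 hL.ne')).1 hcos
  have hodd : 2 * (k : ℝ) + 1 = 2 * (j * L) := by linarith
  have hodd' : 2 * (k : ℤ) + 1 = 2 * (j * L) := by exact_mod_cast hodd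
  omega

theorem modeMean_zero : modeMean Λ J L 0 η = hotBranch Λ J η ^ 2 + coldBranch Λ J η ^ 2 := by
  rw [modeMean, mul_zero, zero_div, cos_zero, mul_one, A₀_sub_A₁]

theorem modeDisc_zero :
    modeDisc Λ J L 0 η = (hotBranch Λ J η ^ 2 - coldBranch Λ J η ^ 2) ^ 2 := by
  rw [modeDisc, modeMean_zero, mul_zero, zero_div, cos_zero]
  linear_combination (-A₂ Λ J η - A₃ Λ J η - 2 * hotBranch Λ J η * coldBranch Λ J η) *
    A₂_add_A₃ (Λ := Λ) (J := J) (η := η)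

theorem add_add_sqrt_sub_sq_div_two (x y : ℝ) : (x + y + √((x - y) ^ 2)) / 2 = max x y := by
  rw [sqrt_sq_eq_abs]
  rcases le_total x y with h | h
  · rw [max_eq_right h, abs_of_nonpos (sub_nonpos.2 h)]
    ring
  · rw [max_eq_left h, abs_of_nonneg (sub_nonneg.2 h)]
    ring

theorem modeFreeEnergy_zero (hJ : J.Ferromagnetic Λ) (hη : 0 < η) :
    modeFreeEnergy Λ J L 0 η =
      -(1 / (cellSites Λ * L)) * log (max (hotBranch Λ J η) (coldBranch Λ J η)) := by
  have hmax : max (hotBranch Λ J η ^ 2) (coldBranch Λ J η ^ 2) =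
      max (hotBranch Λ J η) (coldBranch Λ J η) ^ 2 :=
    (pow_left_monotoneOn.map_max (hotBranch_pos hJ hη).le (coldBranch_pos hJ hη).le).symm
  rw [modeFreeEnergy_eq hJ hη, modeMean_zero, modeDisc_zero, add_add_sqrt_sub_sq_div_two, hmax,
    log_pow, Nat.cast_ofNat]
  field_simp

theorem contDiff_neg_log_R : ContDiff ℝ n fun η => -log (R Λ J η) := by
  have hcosh : ContDiff ℝ n fun η => cosh (η₁ Λ J η) * cosh (η₂ Λ J η) * cosh (η₃ Λ J η) := by
    unfold η₁ η₂ η₃; fun_prop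
  have hpos (η : ℝ) : 0 < cosh (η₁ Λ J η) * cosh (η₂ Λ J η) * cosh (η₃ Λ J η) := by positivity
  refine (ContDiff.log ?_ fun η => ?_).neg
  · cases Λ
    exacts [contDiff_const.mul hcosh, contDiff_const.mul hcosh,
      contDiff_const.mul (hcosh.sqrt fun η => (hpos η).ne')]
  · cases Λ
    exacts [(mul_pos two_pos (hpos η)).ne', (mul_pos two_pos (hpos η)).ne',
      (mul_pos two_pos (sqrt_pos.2 (hpos η))).ne']

theorem contDiffOn_freeEnergy_periodic (hJ : J.Ferromagnetic Λ) (hL : 0 < L) :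
    ContDiffOn ℝ n (freeEnergy Λ J L .periodic) (Ioi 0) :=
  contDiff_neg_log_R.contDiffOn.add
    (ContDiffOn.sum fun k _ => contDiffOn_modeFreeEnergy_natCast_add_half hJ hL k)

end Modes

section Temperature

variable {Λ : Lattice} {J : Couplings} {kB ηc : ℝ}

theorem reduced_reduced (hJ : J.Ferromagnetic Λ) (hkB : kB ≠ 0) (η : ℝ) :
    reduced Λ J kB (reduced Λ J kB η) = η := by
  have hJref := (Jref_pos hJ).ne'
  unfold reduced
  field_simp

theorem reduced_pos (hJ : J.Ferromagnetic Λ) (hkB : 0 < kB) (hηc : 0 < ηc) :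
    0 < reduced Λ J kB ηc :=
  div_pos (Jref_pos hJ) (mul_pos hkB hηc)

theorem strictAntiOn_reduced (hJ : J.Ferromagnetic Λ) (hkB : 0 < kB) :
    StrictAntiOn (reduced Λ J kB) (Ioi 0) := fun _ hx _ _ hxy =>
  div_lt_div_of_pos_left (Jref_pos hJ) (mul_pos hkB hx) (mul_lt_mul_of_pos_left hxy hkB)

theorem tendsto_reduced (hJ : J.Ferromagnetic Λ) (hkB : 0 < kB) (hηc : 0 < ηc) :
    Tendsto (reduced Λ J kB) (𝓝 (reduced Λ J kB ηc)) (𝓝 ηc) := by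
  have hTc := mul_pos hkB (reduced_pos hJ hkB hηc)
  have hcont : ContinuousAt (reduced Λ J kB) (reduced Λ J kB ηc) :=
    continuousAt_const.div (continuousAt_const.mul continuousAt_id) hTc.ne'
  simpa only [ContinuousAt, reduced_reduced hJ hkB.ne'] using hcont

theorem tendsto_reduced_nhdsGT (hJ : J.Ferromagnetic Λ) (hkB : 0 < kB) (hηc : 0 < ηc) :
    Tendsto (reduced Λ J kB) (𝓝[>] reduced Λ J kB ηc) (𝓝[<] ηc) := by
  have hTc := reduced_pos hJ hkB hηc
  refine tendsto_nhdsWithin_iff.2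
    ⟨(tendsto_reduced hJ hkB hηc).mono_left nhdsWithin_le_nhds, ?_⟩
  filter_upwards [self_mem_nhdsWithin] with T hT
  have hlt := strictAntiOn_reduced hJ hkB hTc (hTc.trans hT) hT
  rwa [reduced_reduced hJ hkB.ne'] at hlt

theorem tendsto_reduced_nhdsLT (hJ : J.Ferromagnetic Λ) (hkB : 0 < kB) (hηc : 0 < ηc) :
    Tendsto (reduced Λ J kB) (𝓝[<] reduced Λ J kB ηc) (𝓝[>] ηc) := by
  have hTc := reduced_pos hJ hkB hηc
  refine tendsto_nhdsWithin_iff.2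
    ⟨(tendsto_reduced hJ hkB hηc).mono_left nhdsWithin_le_nhds, ?_⟩
  filter_upwards [Ioo_mem_nhdsLT hTc] with T hT
  have hlt := strictAntiOn_reduced hJ hkB hT.1 hTc hT.2
  rwa [reduced_reduced hJ hkB.ne'] at hlt

theorem hasCriticalGap_comp_reduced {g : ℝ → ℝ} {a b : ℝ} (hJ : J.Ferromagnetic Λ) (hkB : 0 < kB)
    (hηc : 0 < ηc) (hl : Tendsto g (𝓝[<] ηc) (𝓝 a)) (hr : Tendsto g (𝓝[>] ηc) (𝓝 b)) :
    HasCriticalGap (fun T => g (reduced Λ J kB T)) (reduced Λ J kB ηc) (a - b) :=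
  ⟨a, b, hl.comp (tendsto_reduced_nhdsGT hJ hkB hηc), hr.comp (tendsto_reduced_nhdsLT hJ hkB hηc),
    rfl⟩

variable {L : ℕ} {b : Joining} {U V : ℝ → ℝ}

theorem hasCriticalGap_internalEnergy (hJ : J.Ferromagnetic Λ) (hkB : 0 < kB) (hηc : 0 < ηc)
    (hU : freeEnergy Λ J L b =ᶠ[𝓝[<] ηc] U) (hV : freeEnergy Λ J L b =ᶠ[𝓝[>] ηc] V)
    (hU₁ : ContDiffAt ℝ 1 U ηc) (hV₁ : ContDiffAt ℝ 1 V ηc) :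
    HasCriticalGap (fun T => internalEnergy Λ J L b (reduced Λ J kB T)) (reduced Λ J kB ηc)
      (deriv U ηc - deriv V ηc) :=
  hasCriticalGap_comp_reduced hJ hkB hηc (tendsto_deriv_of_eventuallyEq isOpen_Iio hU hU₁)
    (tendsto_deriv_of_eventuallyEq isOpen_Ioi hV hV₁)

theorem hasCriticalGap_specificHeat (hJ : J.Ferromagnetic Λ) (hkB : 0 < kB) (hηc : 0 < ηc)
    (hU : freeEnergy Λ J L b =ᶠ[𝓝[<] ηc] U) (hV : freeEnergy Λ J L b =ᶠ[𝓝[>] ηc] V)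
    (hU₂ : ContDiffAt ℝ 2 U ηc) (hV₂ : ContDiffAt ℝ 2 V ηc) :
    HasCriticalGap (fun T => specificHeat Λ J L b (reduced Λ J kB T)) (reduced Λ J kB ηc)
      (-ηc ^ 2 * deriv (deriv U) ηc - -ηc ^ 2 * deriv (deriv V) ηc) := by
  have hsq {s : Set ℝ} : Tendsto (fun η : ℝ => -η ^ 2) (𝓝[s] ηc) (𝓝 (-ηc ^ 2)) :=
    ((continuous_pow 2).neg.tendsto ηc).mono_left nhdsWithin_le_nhds
  exact hasCriticalGap_comp_reduced hJ hkB hηc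
    (hsq.mul (tendsto_deriv_deriv_of_eventuallyEq isOpen_Iio hU hU₂))
    (hsq.mul (tendsto_deriv_deriv_of_eventuallyEq isOpen_Ioi hV hV₂))

end Temperature

section Periodic

variable {Λ : Lattice} {J : Couplings} {L : ℕ} {kB ηc : ℝ}

theorem contDiffAt_freeEnergy_periodic {n : WithTop ℕ∞} (hJ : J.Ferromagnetic Λ) (hL : 0 < L)
    (hηc : 0 < ηc) : ContDiffAt ℝ n (freeEnergy Λ J L .periodic) ηc :=
  (contDiffOn_freeEnergy_periodic hJ hL).contDiffAt (Ioi_mem_nhds hηc)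

theorem hasCriticalGap_internalEnergy_periodic (hJ : J.Ferromagnetic Λ) (hL : 0 < L) (hkB : 0 < kB)
    (hηc : 0 < ηc) :
    HasCriticalGap (fun T => internalEnergy Λ J L .periodic (reduced Λ J kB T))
      (reduced Λ J kB ηc) 0 := by
  have hf := contDiffAt_freeEnergy_periodic (n := 1) hJ hL hηc
  simpa only [sub_self] using hasCriticalGap_internalEnergy hJ hkB hηc .rfl .rfl hf hf

theorem hasCriticalGap_specificHeat_periodic (hJ : J.Ferromagnetic Λ) (hL : 0 < L) (hkB : 0 < kB)
    (hηc : 0 < ηc) :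
    HasCriticalGap (fun T => specificHeat Λ J L .periodic (reduced Λ J kB T))
      (reduced Λ J kB ηc) 0 := by
  have hf := contDiffAt_freeEnergy_periodic (n := 2) hJ hL hηc
  simpa only [sub_self] using hasCriticalGap_specificHeat hJ hkB hηc .rfl .rfl hf hf

theorem not_hasFirstOrderTransition_freeEnergy_periodic (hJ : J.Ferromagnetic Λ) (hL : 0 < L)
    (hηc : 0 < ηc) : ¬ HasFirstOrderTransition (freeEnergy Λ J L .periodic) ηc :=
  not_hasFirstOrderTransition_of_differentiableAt
    ((contDiffAt_freeEnergy_periodic (n := 1) hJ hL hηc).differentiableAt one_ne_zero)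

end Periodic

section Antiperiodic

variable {Λ : Lattice} {J : Couplings} {L : ℕ} {η ηc kB : ℝ} {n : WithTop ℕ∞} {B : ℝ → ℝ}

/-- The free energy of the antiperiodic cylinder without its zero mode. -/
noncomputable def regularPart (Λ : Lattice) (J : Couplings) (L : ℕ) (η : ℝ) : ℝ :=
  -log (R Λ J η) + ∑ k ∈ Finset.Ico 1 L, modeFreeEnergy Λ J L k η

/-- The free energy the antiperiodic cylinder would have if `B`, which is either `hotBranch` or
`coldBranch`, were the larger of the two branches at every temperature. -/
noncomputable def phaseFreeEnergy (Λ : Lattice) (J : Couplings) (L : ℕ) (B : ℝ → ℝ) (η : ℝ) : ℝ :=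
  regularPart Λ J L η - 1 / (cellSites Λ * L) * log (B η)

theorem contDiffOn_regularPart (hJ : J.Ferromagnetic Λ) :
    ContDiffOn ℝ n (regularPart Λ J L) (Ioi 0) :=
  contDiff_neg_log_R.contDiffOn.add <| ContDiffOn.sum fun _ hk =>
    contDiffOn_modeFreeEnergy_natCast hJ (Finset.mem_Ico.1 hk).1 (Finset.mem_Ico.1 hk).2

theorem contDiffOn_phaseFreeEnergy (hJ : J.Ferromagnetic Λ) (hB : ContDiffOn ℝ n B (Ioi 0))
    (hB₀ : ∀ η ∈ Ioi 0, B η ≠ 0) : ContDiffOn ℝ n (phaseFreeEnergy Λ J L B) (Ioi 0) :=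
  (contDiffOn_regularPart hJ).sub (contDiffOn_const.mul (hB.log hB₀))

theorem contDiffOn_phaseFreeEnergy_hotBranch (hJ : J.Ferromagnetic Λ) :
    ContDiffOn ℝ n (phaseFreeEnergy Λ J L (hotBranch Λ J)) (Ioi 0) :=
  contDiffOn_phaseFreeEnergy hJ contDiff_hotBranch.contDiffOn fun _ hη => (hotBranch_pos hJ hη).ne'

theorem contDiffOn_phaseFreeEnergy_coldBranch (hJ : J.Ferromagnetic Λ) :
    ContDiffOn ℝ n (phaseFreeEnergy Λ J L (coldBranch Λ J)) (Ioi 0) :=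
  contDiffOn_phaseFreeEnergy hJ contDiff_coldBranch.contDiffOn
    fun _ hη => (coldBranch_pos hJ hη).ne'

theorem contDiffAt_phaseFreeEnergy_hotBranch (hJ : J.Ferromagnetic Λ) (hη : 0 < η) :
    ContDiffAt ℝ n (phaseFreeEnergy Λ J L (hotBranch Λ J)) η :=
  (contDiffOn_phaseFreeEnergy_hotBranch hJ).contDiffAt (Ioi_mem_nhds hη)

theorem contDiffAt_phaseFreeEnergy_coldBranch (hJ : J.Ferromagnetic Λ) (hη : 0 < η) :
    ContDiffAt ℝ n (phaseFreeEnergy Λ J L (coldBranch Λ J)) η :=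
  (contDiffOn_phaseFreeEnergy_coldBranch hJ).contDiffAt (Ioi_mem_nhds hη)

theorem phaseFreeEnergy_hotBranch_sub_coldBranch :
    phaseFreeEnergy Λ J L (hotBranch Λ J) η - phaseFreeEnergy Λ J L (coldBranch Λ J) η =
      logRatio Λ J η / (cellSites Λ * L) := by
  unfold phaseFreeEnergy logRatio
  ring

theorem cellSites_pos : 0 < cellSites Λ := by
  cases Λ <;> norm_num [cellSites]

theorem cellSites_mul_pos (hL : 0 < L) : 0 < cellSites Λ * L :=
  mul_pos cellSites_pos (Nat.cast_pos.2 hL)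

theorem freeEnergy_antiperiodic_eq_add (hL : 0 < L) :
    freeEnergy Λ J L .antiperiodic η = regularPart Λ J L η + modeFreeEnergy Λ J L 0 η := by
  simp only [freeEnergy, regularPart, Joining.shift, add_zero]
  rw [Finset.range_eq_Ico, Finset.sum_eq_sum_Ico_succ_bot hL, Nat.cast_zero]
  ring

theorem freeEnergy_antiperiodic_eq_min (hJ : J.Ferromagnetic Λ) (hL : 0 < L) (hη : 0 < η) :
    freeEnergy Λ J L .antiperiodic η =
      min (phaseFreeEnergy Λ J L (hotBranch Λ J) η) (phaseFreeEnergy Λ J L (coldBranch Λ J) η) := by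
  have hanti : AntitoneOn (fun x => regularPart Λ J L η - 1 / (cellSites Λ * L) * log x)
      (Ioi 0) := fun x hx y _ hxy =>
    sub_le_sub_left (mul_le_mul_of_nonneg_left (log_le_log hx hxy)
      (one_div_nonneg.2 (cellSites_mul_pos hL).le)) _
  rw [freeEnergy_antiperiodic_eq_add hL, modeFreeEnergy_zero hJ hη, neg_mul, ← sub_eq_add_neg]
  exact hanti.map_max (hotBranch_pos hJ hη) (coldBranch_pos hJ hη)

theorem continuousOn_freeEnergy_antiperiodic (hJ : J.Ferromagnetic Λ) (hL : 0 < L) :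
    ContinuousOn (freeEnergy Λ J L .antiperiodic) (Ioi 0) :=
  ((contDiffOn_phaseFreeEnergy_hotBranch (n := 0) hJ).continuousOn.inf
    (contDiffOn_phaseFreeEnergy_coldBranch (n := 0) hJ).continuousOn).congr
      fun _ hη => freeEnergy_antiperiodic_eq_min hJ hL hη

theorem freeEnergy_antiperiodic_eqOn_hot (hJ : J.Ferromagnetic Λ) (hL : 0 < L)
    (hc : IsCritical Λ J ηc) :
    EqOn (freeEnergy Λ J L .antiperiodic) (phaseFreeEnergy Λ J L (hotBranch Λ J)) (Ioc 0 ηc) := by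
  intro η hη
  rw [freeEnergy_antiperiodic_eq_min hJ hL hη.1, min_eq_left_iff, ← sub_nonpos,
    phaseFreeEnergy_hotBranch_sub_coldBranch]
  exact div_nonpos_of_nonpos_of_nonneg (logRatio_nonpos hJ hc hη.1 hη.2) (cellSites_mul_pos hL).le

theorem freeEnergy_antiperiodic_eqOn_cold (hJ : J.Ferromagnetic Λ) (hL : 0 < L)
    (hc : IsCritical Λ J ηc) :
    EqOn (freeEnergy Λ J L .antiperiodic) (phaseFreeEnergy Λ J L (coldBranch Λ J)) (Ici ηc) := by
  intro η hη
  rw [freeEnergy_antiperiodic_eq_min hJ hL (hc.1.trans_le hη), min_eq_right_iff, ← sub_nonneg,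
    phaseFreeEnergy_hotBranch_sub_coldBranch]
  exact div_nonneg (logRatio_nonneg hJ hc hη) (cellSites_mul_pos hL).le

theorem freeEnergy_antiperiodic_eventuallyEq_hot (hJ : J.Ferromagnetic Λ) (hL : 0 < L)
    (hc : IsCritical Λ J ηc) :
    freeEnergy Λ J L .antiperiodic =ᶠ[𝓝[≤] ηc] phaseFreeEnergy Λ J L (hotBranch Λ J) :=
  (freeEnergy_antiperiodic_eqOn_hot hJ hL hc).eventuallyEq_of_mem (Ioc_mem_nhdsLE hc.1)

theorem freeEnergy_antiperiodic_eventuallyEq_cold (hJ : J.Ferromagnetic Λ) (hL : 0 < L)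
    (hc : IsCritical Λ J ηc) :
    freeEnergy Λ J L .antiperiodic =ᶠ[𝓝[≥] ηc] phaseFreeEnergy Λ J L (coldBranch Λ J) :=
  (freeEnergy_antiperiodic_eqOn_cold hJ hL hc).eventuallyEq_nhdsWithin

theorem contDiffOn_freeEnergy_antiperiodic (hJ : J.Ferromagnetic Λ) (hL : 0 < L)
    (hc : IsCritical Λ J ηc) :
    ContDiffOn ℝ n (freeEnergy Λ J L .antiperiodic) (Ioi 0 \ {ηc}) := by
  rintro η ⟨hη, hne⟩
  rcases lt_or_gt_of_ne hne with hlt | hgt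
  · exact ((contDiffAt_phaseFreeEnergy_hotBranch hJ hη).congr_of_eventuallyEq
      ((freeEnergy_antiperiodic_eqOn_hot hJ hL hc).eventuallyEq_of_mem
        (Ioc_mem_nhds hη hlt))).contDiffWithinAt
  · exact ((contDiffAt_phaseFreeEnergy_coldBranch hJ hη).congr_of_eventuallyEq
      ((freeEnergy_antiperiodic_eqOn_cold hJ hL hc).eventuallyEq_of_mem
        (Ici_mem_nhds hgt))).contDiffWithinAt

theorem deriv_phaseFreeEnergy_hotBranch_sub_coldBranch (hJ : J.Ferromagnetic Λ) (hη : 0 < η) :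
    deriv (phaseFreeEnergy Λ J L (hotBranch Λ J)) η
      - deriv (phaseFreeEnergy Λ J L (coldBranch Λ J)) η = aε Λ J η / (cellSites Λ * L) := by
  rw [← deriv_sub
    ((contDiffAt_phaseFreeEnergy_hotBranch (n := 1) hJ hη).differentiableAt one_ne_zero)
    ((contDiffAt_phaseFreeEnergy_coldBranch (n := 1) hJ hη).differentiableAt one_ne_zero),
    ← ((hasDerivAt_logRatio hJ hη).div_const (cellSites Λ * L)).deriv]
  exact congrArg (deriv · η) (funext fun _ => phaseFreeEnergy_hotBranch_sub_coldBranch)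

theorem deriv_deriv_phaseFreeEnergy_hotBranch_sub_coldBranch (hJ : J.Ferromagnetic Λ)
    (hη : 0 < η) :
    deriv (deriv (phaseFreeEnergy Λ J L (hotBranch Λ J))) η
      - deriv (deriv (phaseFreeEnergy Λ J L (coldBranch Λ J))) η =
        -(ac Λ J η / η ^ 2) / (cellSites Λ * L) := by
  have hhot := contDiffAt_deriv (m := 1)
    (contDiffAt_phaseFreeEnergy_hotBranch (L := L) (n := 2) hJ hη) (by norm_num)
  have hcold := contDiffAt_deriv (m := 1)
    (contDiffAt_phaseFreeEnergy_coldBranch (L := L) (n := 2) hJ hη) (by norm_num)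
  rw [← deriv_sub (hhot.differentiableAt one_ne_zero) (hcold.differentiableAt one_ne_zero),
    ← ((hasDerivAt_aε hJ hη).div_const (cellSites Λ * L)).deriv]
  refine EventuallyEq.deriv_eq ?_
  filter_upwards [Ioi_mem_nhds hη] with x hx
    using deriv_phaseFreeEnergy_hotBranch_sub_coldBranch hJ hx

theorem hasFirstOrderTransition_freeEnergy_antiperiodic (hJ : J.Ferromagnetic Λ) (hL : 0 < L)
    (hc : IsCritical Λ J ηc) :
    HasFirstOrderTransition (freeEnergy Λ J L .antiperiodic) ηc := by
  refine hasFirstOrderTransition_of_eventuallyEq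
    (freeEnergy_antiperiodic_eventuallyEq_hot hJ hL hc)
    (freeEnergy_antiperiodic_eventuallyEq_cold hJ hL hc)
    ((contDiffAt_phaseFreeEnergy_hotBranch (n := 1) hJ hc.1).differentiableAt one_ne_zero)
    ((contDiffAt_phaseFreeEnergy_coldBranch (n := 1) hJ hc.1).differentiableAt one_ne_zero)
    (sub_ne_zero.1 ?_)
  rw [deriv_phaseFreeEnergy_hotBranch_sub_coldBranch hJ hc.1]
  exact (div_pos (aε_pos hJ hc.1) (cellSites_mul_pos hL)).ne'

theorem hasCriticalGap_internalEnergy_antiperiodic (hJ : J.Ferromagnetic Λ) (hL : 0 < L)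
    (hkB : 0 < kB) (hc : IsCritical Λ J ηc) :
    HasCriticalGap (fun T => internalEnergy Λ J L .antiperiodic (reduced Λ J kB T))
      (reduced Λ J kB ηc) (aε Λ J ηc / (cellSites Λ * L)) := by
  rw [← deriv_phaseFreeEnergy_hotBranch_sub_coldBranch hJ hc.1]
  exact hasCriticalGap_internalEnergy hJ hkB hc.1
    ((freeEnergy_antiperiodic_eventuallyEq_hot hJ hL hc).filter_mono
      (nhdsWithin_mono _ Iio_subset_Iic_self))
    ((freeEnergy_antiperiodic_eventuallyEq_cold hJ hL hc).filter_mono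
      (nhdsWithin_mono _ Ioi_subset_Ici_self))
    (contDiffAt_phaseFreeEnergy_hotBranch hJ hc.1) (contDiffAt_phaseFreeEnergy_coldBranch hJ hc.1)

theorem hasCriticalGap_specificHeat_antiperiodic (hJ : J.Ferromagnetic Λ) (hL : 0 < L)
    (hkB : 0 < kB) (hc : IsCritical Λ J ηc) :
    HasCriticalGap (fun T => specificHeat Λ J L .antiperiodic (reduced Λ J kB T))
      (reduced Λ J kB ηc) (ac Λ J ηc / (cellSites Λ * L)) := by
  have hgap := hasCriticalGap_specificHeat hJ hkB hc.1
    ((freeEnergy_antiperiodic_eventuallyEq_hot hJ hL hc).filter_mono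
      (nhdsWithin_mono _ Iio_subset_Iic_self))
    ((freeEnergy_antiperiodic_eventuallyEq_cold hJ hL hc).filter_mono
      (nhdsWithin_mono _ Ioi_subset_Ici_self))
    (contDiffAt_phaseFreeEnergy_hotBranch hJ hc.1) (contDiffAt_phaseFreeEnergy_coldBranch hJ hc.1)
  have hηc := hc.1.ne'
  rw [← mul_sub, deriv_deriv_phaseFreeEnergy_hotBranch_sub_coldBranch hJ hc.1] at hgap
  convert hgap using 1
  field_simp

end Antiperiodic

section ZeroMode

variable {Λ : Lattice} {J : Couplings} {L : ℕ} {η ηc : ℝ}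

theorem cosh_logRatio (hJ : J.Ferromagnetic Λ) (hη : 0 < η) : cosh (logRatio Λ J η) =
    (hotBranch Λ J η ^ 2 + coldBranch Λ J η ^ 2) / (2 * hotBranch Λ J η * coldBranch Λ J η) := by
  have hhot := hotBranch_pos hJ hη
  have hcold := coldBranch_pos hJ hη
  rw [logRatio, ← log_div hcold.ne' hhot.ne', cosh_log (div_pos hcold hhot)]
  field_simp
  ring

theorem G_zero (hJ : J.Ferromagnetic Λ) (hη : 0 < η) :
    G Λ J L 0 η = (cosh (logRatio Λ J η))⁻¹ := by
  have hradicand : A₂ Λ J η ^ 2 + A₃ Λ J η ^ 2 + 2 * A₂ Λ J η * A₃ Λ J η =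
      (2 * hotBranch Λ J η * coldBranch Λ J η) ^ 2 := by
    rw [← A₂_add_A₃]
    ring
  have hnonneg : 0 ≤ 2 * hotBranch Λ J η * coldBranch Λ J η :=
    mul_nonneg (mul_nonneg zero_le_two (hotBranch_pos hJ hη).le) (coldBranch_pos hJ hη).le
  rw [G, mul_zero, zero_div, cos_zero, mul_one, mul_one, hradicand, sqrt_sq hnonneg, A₀_sub_A₁,
    cosh_logRatio hJ hη, inv_div]

theorem sqrt_one_sub_inv_cosh_sq (x : ℝ) : √(1 - (cosh x)⁻¹ ^ 2) = |tanh x| := by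
  have hcosh := (cosh_pos x).ne'
  rw [← sqrt_sq_eq_abs, tanh_eq_sinh_div_cosh]
  congr 1
  field_simp
  linear_combination cosh_sq x

theorem hasDerivAt_log_G_zero (hJ : J.Ferromagnetic Λ) (hη : 0 < η) :
    HasDerivAt (fun x => log (G Λ J L 0 x)) (-(tanh (logRatio Λ J η) * aε Λ J η)) η := by
  have hlog := ((hasDerivAt_logRatio hJ hη).cosh.log (cosh_pos _).ne').neg
  refine (hlog.congr_deriv ?_).congr_of_eventuallyEq ?_
  · rw [tanh_eq_sinh_div_cosh, mul_div_right_comm]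
  · filter_upwards [Ioi_mem_nhds hη] with x hx
    rw [G_zero hJ hx, log_inv]
    rfl

theorem Dε_zero (hJ : J.Ferromagnetic Λ) (hη : 0 < η) : Dε Λ J L 0 η =
    -(tanh (logRatio Λ J η) / |tanh (logRatio Λ J η)|) * aε Λ J η := by
  rw [Dε, (hasDerivAt_log_G_zero hJ hη).deriv, G_zero hJ hη, sqrt_one_sub_inv_cosh_sq]
  ring

theorem Dε_zero_eventuallyEq_nhdsLT (hJ : J.Ferromagnetic Λ) (hc : IsCritical Λ J ηc) :
    Dε Λ J L 0 =ᶠ[𝓝[<] ηc] aε Λ J := by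
  filter_upwards [Ioo_mem_nhdsLT hc.1] with η hη
  have hneg : tanh (logRatio Λ J η) < 0 := by
    simpa only [tanh_zero] using strictMono_tanh (logRatio_neg hJ hc hη.1 hη.2)
  rw [Dε_zero hJ hη.1, abs_of_neg hneg, div_neg, div_self hneg.ne, neg_neg, one_mul]

theorem Dε_zero_eventuallyEq_nhdsGT (hJ : J.Ferromagnetic Λ) (hc : IsCritical Λ J ηc) :
    Dε Λ J L 0 =ᶠ[𝓝[>] ηc] -aε Λ J := by
  filter_upwards [self_mem_nhdsWithin] with η hη
  have hpos := tanh_pos (logRatio_pos hJ hc hη)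
  rw [Dε_zero hJ (hc.1.trans hη), abs_of_pos hpos, div_self hpos.ne', neg_one_mul, Pi.neg_apply]

theorem tendsto_Dε_zero_gap (hJ : J.Ferromagnetic Λ) (hc : IsCritical Λ J ηc) :
    Tendsto (fun x => Dε Λ J L 0 (ηc - x) - Dε Λ J L 0 (ηc + x)) (𝓝[>] 0)
      (𝓝 (2 * aε Λ J ηc)) := by
  have haε : ContinuousAt (aε Λ J) ηc := (contDiffAt_aε (n := 0) hJ hc.1).continuousAt
  have hgap := tendsto_comp_sub_sub_comp_add
    ((haε.mono_left nhdsWithin_le_nhds).congr' (Dε_zero_eventuallyEq_nhdsLT (L := L) hJ hc).symm)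
    ((haε.neg.mono_left nhdsWithin_le_nhds).congr' (Dε_zero_eventuallyEq_nhdsGT hJ hc).symm)
  rwa [Pi.neg_apply, sub_neg_eq_add, ← two_mul] at hgap

theorem tendsto_Dc_zero_gap (hJ : J.Ferromagnetic Λ) (hc : IsCritical Λ J ηc) :
    Tendsto (fun x => Dc Λ J L 0 (ηc - x) - Dc Λ J L 0 (ηc + x)) (𝓝[>] 0)
      (𝓝 (2 * (ac Λ J ηc / ηc ^ 2))) := by
  have haε := contDiffAt_aε (n := 1) hJ hc.1
  have hgap := tendsto_comp_sub_sub_comp_add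
    (tendsto_deriv_of_eventuallyEq isOpen_Iio (Dε_zero_eventuallyEq_nhdsLT (L := L) hJ hc) haε).neg
    (tendsto_deriv_of_eventuallyEq isOpen_Ioi (Dε_zero_eventuallyEq_nhdsGT hJ hc) haε.neg).neg
  rwa [deriv.neg, (hasDerivAt_aε hJ hc.1).deriv, neg_neg, sub_neg_eq_add, ← two_mul] at hgap

end ZeroMode
end IsingCylinder

theorem mainTheorem1 (Λ : Lattice) (J : Couplings) (hJ : J.Ferromagnetic Λ)
    (L : ℕ) (hL : 0 < L) (kB : ℝ) (hkB : 0 < kB) :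
    -- the bulk critical point exists and is unique
    (∃! ηc : ℝ, IsCritical Λ J ηc) ∧
    ∀ ηc : ℝ, IsCritical Λ J ηc →
      -- antiperiodic joining: the only singularity is a first-order transition at the critical point
      (ContinuousOn (freeEnergy Λ J L .antiperiodic) (Ioi 0) ∧
        ContDiffOn ℝ 2 (freeEnergy Λ J L .antiperiodic) (Ioi 0 \ {ηc}) ∧
        HasFirstOrderTransition (freeEnergy Λ J L .antiperiodic) ηc) ∧
      -- the critical gaps and their amplitudes
      (HasCriticalGap (fun T => internalEnergy Λ J L .antiperiodic (reduced Λ J kB T))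
          (reduced Λ J kB ηc) (aε Λ J ηc / (cellSites Λ * L)) ∧
        HasCriticalGap (fun T => specificHeat Λ J L .antiperiodic (reduced Λ J kB T))
          (reduced Λ J kB ηc) (ac Λ J ηc / (cellSites Λ * L)) ∧
        0 < aε Λ J ηc ∧ 0 < ac Λ J ηc) ∧
      -- only the zero mode contributes to the gaps
      (ContDiffOn ℝ 2 (fun η => -Real.log (R Λ J η)) (Ioi 0) ∧
        (∀ pbar : ℕ, 0 < pbar → pbar < L →
          ContDiffOn ℝ 2 (modeFreeEnergy Λ J L pbar) (Ioi 0)) ∧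
        Tendsto (fun x => 1 / (2 * cellSites Λ * L) *
            (Dε Λ J L 0 (ηc - x) - Dε Λ J L 0 (ηc + x)))
          (𝓝[>] 0) (𝓝 (aε Λ J ηc / (cellSites Λ * L))) ∧
        Tendsto (fun x => ηc ^ 2 / (2 * cellSites Λ * L) *
            (Dc Λ J L 0 (ηc - x) - Dc Λ J L 0 (ηc + x)))
          (𝓝[>] 0) (𝓝 (ac Λ J ηc / (cellSites Λ * L)))) ∧
      -- periodic joining: no jump
      (ContDiffOn ℝ 2 (freeEnergy Λ J L .periodic) (Ioi 0) ∧
        HasCriticalGap (fun T => internalEnergy Λ J L .periodic (reduced Λ J kB T))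
          (reduced Λ J kB ηc) 0 ∧
        HasCriticalGap (fun T => specificHeat Λ J L .periodic (reduced Λ J kB T))
          (reduced Λ J kB ηc) 0 ∧
        ¬ HasFirstOrderTransition (freeEnergy Λ J L .periodic) ηc) := by
  refine ⟨existsUnique_isCritical hJ, fun ηc hc => ⟨?_, ?_, ⟨?_, ?_, ?_, ?_⟩, ?_⟩⟩
  · exact ⟨continuousOn_freeEnergy_antiperiodic hJ hL, contDiffOn_freeEnergy_antiperiodic hJ hL hc,
      hasFirstOrderTransition_freeEnergy_antiperiodic hJ hL hc⟩
  · exact ⟨hasCriticalGap_internalEnergy_antiperiodic hJ hL hkB hc,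
      hasCriticalGap_specificHeat_antiperiodic hJ hL hkB hc, aε_pos hJ hc.1, ac_pos hJ hc.1⟩
  · exact contDiff_neg_log_R.contDiffOn
  · exact fun pbar hpos hlt => contDiffOn_modeFreeEnergy_natCast hJ hpos hlt
  · convert (tendsto_Dε_zero_gap hJ hc).const_mul (1 / (2 * cellSites Λ * L)) using 2
    field_simp
  · have hηc := hc.1.ne'
    convert (tendsto_Dc_zero_gap hJ hc).const_mul (ηc ^ 2 / (2 * cellSites Λ * L)) using 2
    field_simp
  · exact ⟨contDiffOn_freeEnergy_periodic hJ hL,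
      hasCriticalGap_internalEnergy_periodic hJ hL hkB hc.1,
      hasCriticalGap_specificHeat_periodic hJ hL hkB hc.1,
      not_hasFirstOrderTransition_freeEnergy_periodic hJ hL hc.1⟩
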